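/- Let $N\ge 1$. A function $f:\mathbb{R}^N\to[0,\infty]$ is called symmetric decreasing if $f(y)\le f(x)$ whenever $|x|\le|y|$, and strictly symmetric decreasing if in addition $f(y)<f(x)$ whenever $|x|<|y|$. For a set $A\subset\mathbb{R}^N$ of finite measure, $A^*$ denotes the open ball centered at the origin with $|A^*|=|A|$ (the empty set if $|A|=0$), and for a non-negative measurable function $u$ with $|\{u>\tau\}|<\infty$ for all $\tau>0$ the symmetric decreasing rearrangement of $u$ is $$u^*(x)=\int_0^\infty \chi_{\{u>t\}^*}(x)\,dt .$$ Let $J:\mathbb{R}\to\mathbb{R}$ be non-negative and convex with $J(0)=0$, let $k\in L_1(\mathbb{R}^N)$ be symmetric decreasing with values in $[0,\infty]$, and put $$E[u]:=\iint_{\mathbb{R}^N\times\mathbb{R}^N}J(u(x)-u(y))\,k(x-y)\,dx\,dy .$$ Then for every non-negative measurable function $u:\mathbb{R}^N\to[0,\infty)$ such that $E[u]<\infty$ and $|\{u>\tau\}|<\infty$ for all $\tau>0$, one has $$E[u]\ge E[u^*].$$ Moreover: 1. If $J$ is strictly convex and $k$ is strictly symmetric decreasing, then $E[u]=E[u^*]$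 if and only if $u$ agrees almost everywhere with a translate of a symmetric decreasing function with values in $[0,\infty]$. 2. If $J(t)=|t|$ for all $t$ and $k$ is strictly symmetric decreasing, then $E[u]=E[u^*]$ if and only if for almost every $\tau>0$ the level set $\{u>\tau\}$ coincides, up to a null set, with a ball (whose center may depend on $\tau$; the empty set counts as a ball). -/

import Mathlib

open MeasureTheory Set
open scoped ENNReal

noncomputable section

namespace SymmRearr

/-- The functional `E[u] = ∬ J(u(x) - u(y)) k(x - y) dx dy` on functions `u` on `ℝ^N`, with value
in `[0, ∞]`. It is meant for `J ≥ 0`; the kernel `k` takes values in `[0, ∞]`. -/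
def energy {N : ℕ} (J : ℝ → ℝ) (k : EuclideanSpace ℝ (Fin N) → ℝ≥0∞)
    (u : EuclideanSpace ℝ (Fin N) → ℝ) : ℝ≥0∞ :=
  ∫⁻ x, ∫⁻ y, ENNReal.ofReal (J (u x - u y)) * k (x - y)

/-- Radially symmetric and non-increasing in `|x|` (in particular `f x = f y` if `|x| = |y|`).
The value `∞` is allowed, so that functions that are unbounded near the origin are covered. -/
def IsSymmDecreasing {N : ℕ} (f : EuclideanSpace ℝ (Fin N) → ℝ≥0∞) : Prop :=
  ∀ x y, ‖x‖ ≤ ‖y‖ → f y ≤ f x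

/-- Radially symmetric and strictly decreasing in `|x|`. -/
def IsStrictSymmDecreasing {N : ℕ} (f : EuclideanSpace ℝ (Fin N) → ℝ≥0∞) : Prop :=
  IsSymmDecreasing f ∧ ∀ x y, ‖x‖ < ‖y‖ → f y < f x

/-- The rearrangement `A*` of a set `A ⊆ ℝ^N` of finite measure: the open ball centred at the
origin with the volume of `A`, that is, with radius `(|A| / |B_1|)^(1/N)`. -/
def setRearr {N : ℕ} (A : Set (EuclideanSpace ℝ (Fin N))) : Set (EuclideanSpace ℝ (Fin N)) :=
  Metric.ball 0 (((volume A).toReal /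
    (volume (Metric.ball (0 : EuclideanSpace ℝ (Fin N)) 1)).toReal) ^ ((1 : ℝ) / (N : ℝ)))

/-- The symmetric decreasing rearrangement `u*` of a non-negative function `u` all of whose level
sets `{u > t}`, `t > 0`, have finite measure: `u*(x) = ∫_0^∞ χ_{{u > t}*}(x) dt`.
It is finite at every `x ≠ 0`, and `u*(0)` is the essential supremum of `u`, possibly `∞`. -/
def rearr {N : ℕ} (u : EuclideanSpace ℝ (Fin N) → ℝ) (x : EuclideanSpace ℝ (Fin N)) : ℝ≥0∞ :=
  ∫⁻ t in Ioi (0 : ℝ), (setRearr {y | t < u y}).indicator (fun _ => (1 : ℝ≥0∞)) x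

/-- `u*` as a real-valued function; this changes `u*` at most at the origin, a null set. -/
def rearrReal {N : ℕ} (u : EuclideanSpace ℝ (Fin N) → ℝ) (x : EuclideanSpace ℝ (Fin N)) : ℝ :=
  (rearr u x).toReal

/-- The non-negative function `u` agrees almost everywhere with a translate of a symmetric
decreasing function. -/
def IsTranslateOfSymmDecreasing {N : ℕ} (u : EuclideanSpace ℝ (Fin N) → ℝ) : Prop :=
  ∃ (a : EuclideanSpace ℝ (Fin N)) (g : EuclideanSpace ℝ (Fin N) → ℝ≥0∞),
    IsSymmDecreasing g ∧ ∀ᵐ x, ENNReal.ofReal (u x) = g (x - a)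

/-- For almost every `τ > 0` the level set `{u > τ}` is a ball, up to a null set; the centre may
depend on `τ`, and the empty set counts as a ball (of radius `0`). -/
def LevelSetsAreBalls {N : ℕ} (u : EuclideanSpace ℝ (Fin N) → ℝ) : Prop :=
  ∀ᵐ τ ∂(volume.restrict (Ioi (0 : ℝ))), ∃ (a : EuclideanSpace ℝ (Fin N)) (r : ℝ),
    {x | τ < u x} =ᵐ[volume] Metric.ball a r

end SymmRearr

end

noncomputable section

namespace SymmRearr

/-! The engine is polarization: given a hyperplane and a chosen side, the larger of the values of
`u` at two mirror points is placed on that side. Group the double integral into quadruples of mirror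
points. Convexity of `J` and monotonicity of `k` then give a rearrangement inequality for four
values, so polarization does not increase the energy (`energy_pol_le`). If `J` is strictly convex,
`k` strictly decreasing and the energy finite, equality forces `u` to be ordered across the
hyperplane: almost everywhere, one and the same side carries the larger value
(`ordered_of_energy_pol_eq`).

Rearrangement is a limit of polarizations. For bounded `u` with bounded support, take a class of
functions equidistributed with `u` and stable under polarization, and the infimum of the L¹ distance
to `u*` over it. Polarizing `f` towards the side of the origin lowers this distance by an explicit
gain. Averaged over all hyperplanes, the gain controls `∫ q(t)² dt`, where `q(t) = |{u* > t} \ {f >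
t}|`, while the distance is `2 ∫ q(t) dt`. Near-minimizers have small gains, so the infimum is zero
(`exists_dist1_lt`); no compactness is needed. Fatou's lemma gives the inequality for such `u`, and
cut-offs and truncations give it in general (`energy_rearrReal_le`).

In the strictly convex case of equality, `u` and its polarizations have the same rearrangement, so
no polarization changes the energy and `u` is ordered across every hyperplane. In each coordinate
direction some hyperplane halves the mass, and order together with equal mass is symmetry. Composing
these symmetries gives a point reflection. Around its centre the order can only favour the side
containing the centre, which makes `u` a translate of `u*` (`IsOrdered.exists_translate`).

For `J(t) = |t|`, the coarea formula splits both energies over level sets. Differences of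
characteristic functions lie in `{-1, 0, 1}`, where `|t| = t²`, so the strictly convex case applies
to almost every level set. -/

/-- Euclidean space of dimension `N`. -/
abbrev Sp (N : ℕ) := EuclideanSpace ℝ (Fin N)

variable {N : ℕ}

/-! ### Reflections in hyperplanes -/

/-- The reflection in the hyperplane `{x | ⟪x, e⟫ = s}`, for a unit vector `e`. -/
def refl (e : Sp N) (s : ℝ) (x : Sp N) : Sp N := x - (2 * (inner ℝ x e - s)) • e

lemma inner_refl {e : Sp N} (he : ‖e‖ = 1) (s : ℝ) (x : Sp N) :
    inner ℝ (refl e s x) e = 2 * s - inner ℝ x e := by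
  have h : inner ℝ e e = (1 : ℝ) := by rw [real_inner_self_eq_norm_sq, he]; norm_num
  simp only [refl, inner_sub_left, real_inner_smul_left, h]
  ring

lemma refl_refl {e : Sp N} (he : ‖e‖ = 1) (s : ℝ) (x : Sp N) : refl e s (refl e s x) = x := by
  have h := inner_refl he s x
  conv_lhs => rw [refl, h]
  rw [refl, sub_sub, ← add_smul]
  ring_nf
  simp

lemma refl_of_inner_eq {e : Sp N} {s : ℝ} {x : Sp N} (hx : inner ℝ x e = s) :
    refl e s x = x := by
  simp [refl, hx]

lemma refl_sub_refl {e : Sp N} (s : ℝ) (x y : Sp N) :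
    refl e s x - refl e s y = (x - y) - (2 * inner ℝ (x - y) e) • e := by
  simp only [refl, inner_sub_left]
  module

lemma norm_refl_sub_refl {e : Sp N} (he : ‖e‖ = 1) (s : ℝ) (x y : Sp N) :
    ‖refl e s x - refl e s y‖ = ‖x - y‖ := by
  rw [refl_sub_refl, ← sq_eq_sq₀ (norm_nonneg _) (norm_nonneg _), norm_sub_sq_real, norm_smul,
    real_inner_smul_right, he, mul_one, Real.norm_eq_abs, sq_abs]
  ring

lemma norm_sub_refl_comm {e : Sp N} (he : ‖e‖ = 1) (s : ℝ) (x y : Sp N) :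
    ‖refl e s x - y‖ = ‖x - refl e s y‖ := by
  rw [← norm_refl_sub_refl he s, refl_refl he]

/-- The added term is four times the product of the signed distances of `x` and `y` to the
hyperplane. Its sign decides whether `x` is closer to `y` or to the mirror image of `y`, and every
comparison of distances below comes from this. -/
lemma norm_sub_refl_sq {e : Sp N} (he : ‖e‖ = 1) (s : ℝ) (x y : Sp N) :
    ‖x - refl e s y‖ ^ 2 = ‖x - y‖ ^ 2 + 4 * (s - inner ℝ x e) * (s - inner ℝ y e) := by
  have : x - refl e s y = (x - y) + (2 * (inner ℝ y e - s)) • e := by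
    simp only [refl]; module
  rw [this, norm_add_sq_real, norm_smul, real_inner_smul_right, he, mul_one, Real.norm_eq_abs,
    sq_abs, inner_sub_left]
  ring

lemma norm_refl_sq {e : Sp N} (he : ‖e‖ = 1) (s : ℝ) (y : Sp N) :
    ‖refl e s y‖ ^ 2 = ‖y‖ ^ 2 + 4 * s * (s - inner ℝ y e) := by
  have := norm_sub_refl_sq he s 0 y
  simpa using this

lemma norm_le_norm_refl {e : Sp N} (he : ‖e‖ = 1) {s : ℝ} (hs : 0 ≤ s) {y : Sp N}
    (hy : inner ℝ y e ≤ s) : ‖y‖ ≤ ‖refl e s y‖ := by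
  rw [← sq_le_sq₀ (norm_nonneg _) (norm_nonneg _), norm_refl_sq he]
  nlinarith [mul_nonneg hs (sub_nonneg.2 hy)]

lemma measurePreserving_refl {e : Sp N} (he : ‖e‖ = 1) (s : ℝ) :
    MeasurePreserving (refl e s) volume volume := by
  let L : Sp N ≃ₗᵢ[ℝ] Sp N := (ℝ ∙ e)ᗮ.reflection
  have h : refl e s = (fun x => x + (2 * s) • e) ∘ L := by
    ext1 x
    simp only [refl, Function.comp, L, Submodule.reflection_orthogonal_apply,
      Submodule.reflection_singleton_apply, he]
    rw [real_inner_comm]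
    simp
    module
  rw [h]
  exact (measurePreserving_add_right volume _).comp L.measurePreserving

lemma measurable_refl (e : Sp N) (s : ℝ) : Measurable (refl e s) := by
  unfold refl; fun_prop

lemma measurable_refl_uncurry {α : Type*} [MeasurableSpace α] {e : α → Sp N} {s : α → ℝ}
    {x : α → Sp N} (he : Measurable e) (hs : Measurable s) (hx : Measurable x) :
    Measurable fun a => refl (e a) (s a) (x a) := by
  unfold refl; fun_prop

lemma lintegral_refl {e : Sp N} (he : ‖e‖ = 1) (s : ℝ) {F : Sp N → ℝ≥0∞} (hF : Measurable F) :
    ∫⁻ x, F (refl e s x) = ∫⁻ x, F x :=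
  (measurePreserving_refl he s).lintegral_comp hF

lemma lintegral_add_refl {e : Sp N} (he : ‖e‖ = 1) (s : ℝ) {F : Sp N → ℝ≥0∞}
    (hF : Measurable F) : ∫⁻ x, (F x + F (refl e s x)) = 2 * ∫⁻ x, F x := by
  rw [lintegral_add_left hF, lintegral_refl he s hF, two_mul]

/-! ### Polarization -/

/-- The polarization of `f` with respect to the half-space `{x | ⟪x, e⟫ < s}`. -/
def pol (e : Sp N) (s : ℝ) (f : Sp N → ℝ) (x : Sp N) : ℝ :=
  if inner ℝ x e < s then max (f x) (f (refl e s x)) else min (f x) (f (refl e s x))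

lemma pol_of_lt {e : Sp N} {s : ℝ} {f : Sp N → ℝ} {x : Sp N} (hx : inner ℝ x e < s) :
    pol e s f x = max (f x) (f (refl e s x)) := if_pos hx

lemma pol_refl_of_lt {e : Sp N} (he : ‖e‖ = 1) {s : ℝ} {f : Sp N → ℝ} {x : Sp N}
    (hx : inner ℝ x e < s) : pol e s f (refl e s x) = min (f x) (f (refl e s x)) := by
  rw [pol, if_neg, refl_refl he, min_comm]
  rw [inner_refl he]; linarith

lemma pol_of_eq {e : Sp N} {s : ℝ} {f : Sp N → ℝ} {x : Sp N}
    (hx : inner ℝ x e = s) : pol e s f x = f x := by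
  rw [pol, refl_of_inner_eq hx]; simp

lemma measurable_pol (e : Sp N) (s : ℝ) {f : Sp N → ℝ} (hf : Measurable f) :
    Measurable (pol e s f) := by
  unfold pol
  refine Measurable.ite (measurableSet_lt (by fun_prop) measurable_const) ?_ ?_
  · exact hf.max (hf.comp (measurable_refl e s))
  · exact hf.min (hf.comp (measurable_refl e s))

/-- A property invariant under the reflection may be checked on the closed half-space. -/
lemma forall_of_half {e : Sp N} (he : ‖e‖ = 1) (s : ℝ) {p : Sp N → Prop}
    (h1 : ∀ x, inner ℝ x e ≤ s → p x) (h2 : ∀ x, p (refl e s x) → p x) (x : Sp N) : p x := by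
  by_cases hx : inner ℝ x e ≤ s
  · exact h1 x hx
  · exact h2 x (h1 _ (by rw [inner_refl he]; linarith))

/-- On each mirror pair polarization only permutes the two values, so integrals agree after summing
over pairs. -/
lemma lintegral_comp_pol {e : Sp N} (he : ‖e‖ = 1) (s : ℝ) {f : Sp N → ℝ} (hf : Measurable f)
    {φ : ℝ → ℝ≥0∞} (hφ : Measurable φ) : ∫⁻ x, φ (pol e s f x) = ∫⁻ x, φ (f x) := by
  have key : ∀ x, φ (pol e s f x) + φ (pol e s f (refl e s x)) = φ (f x) + φ (f (refl e s x)) := by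
    refine forall_of_half he s (fun x hx => ?_) (fun x h => ?_)
    · rcases hx.lt_or_eq with hx | hx
      · rw [pol_of_lt hx, pol_refl_of_lt he hx]
        rcases le_total (f x) (f (refl e s x)) with h | h
        · rw [max_eq_right h, min_eq_left h, add_comm]
        · rw [max_eq_left h, min_eq_right h]
      · rw [refl_of_inner_eq hx, pol_of_eq hx]
    · rw [refl_refl he] at h
      rw [add_comm, h, add_comm]
  have h2 : 2 * ∫⁻ x, φ (pol e s f x) = 2 * ∫⁻ x, φ (f x) := by
    have h3 := lintegral_add_refl he s (hφ.comp (measurable_pol e s hf))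
    have h4 := lintegral_add_refl he s (hφ.comp hf)
    exact h3.symm.trans ((lintegral_congr key).trans h4)
  exact (ENNReal.mul_right_inj (by norm_num) (by norm_num)).1 h2

lemma volume_pol_level {e : Sp N} (he : ‖e‖ = 1) (s : ℝ) {f : Sp N → ℝ} (hf : Measurable f)
    (t : ℝ) : volume {x | t < pol e s f x} = volume {x | t < f x} := by
  have h := lintegral_comp_pol he s hf (φ := (Ioi t).indicator 1)
    (measurable_one.indicator measurableSet_Ioi)
  have h3 : ∀ g : Sp N → ℝ, Measurable g →
      ∫⁻ x, (Ioi t).indicator (1 : ℝ → ℝ≥0∞) (g x) = volume {x | t < g x} := by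
    intro g hg
    rw [← lintegral_indicator_one (measurableSet_lt measurable_const hg)]
    rfl
  rwa [h3 _ (measurable_pol e s hf), h3 _ hf] at h

/-! ### Radial functions -/

lemma exists_norm_eq_of_pos (hN : 1 ≤ N) {r : ℝ} (hr : 0 ≤ r) : ∃ x : Sp N, ‖x‖ = r := by
  have : Nonempty (Fin N) := ⟨⟨0, hN⟩⟩
  exact exists_norm_eq (Sp N) hr

lemma IsSymmDecreasing.norm_congr {f : Sp N → ℝ≥0∞} (hf : IsSymmDecreasing f) {x y : Sp N}
    (h : ‖x‖ = ‖y‖) : f x = f y :=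
  le_antisymm (hf _ _ h.ge) (hf _ _ h.le)

/-- Such a function is an antitone function of the norm. For `1 ≤ N` every radius is attained, so
the profile is defined on all of `ℝ`. -/
lemma IsSymmDecreasing.measurable (hN : 1 ≤ N) {f : Sp N → ℝ≥0∞} (hf : IsSymmDecreasing f) :
    Measurable f := by
  choose v hv using fun r : ℝ => exists_norm_eq_of_pos hN (le_max_right r 0)
  have h1 : Antitone fun r => f (v r) := fun a b hab => hf _ _ (by
    rw [hv, hv]; exact max_le_max_right 0 hab)
  have h2 : f = (fun r => f (v r)) ∘ norm := by
    ext x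
    exact hf.norm_congr (by rw [hv, max_eq_left (norm_nonneg x)])
  rw [h2]
  exact h1.measurable.comp measurable_norm

/-! ### Convexity of the integrand -/

lemma continuous_of_convexOn_univ {J : ℝ → ℝ} (hJ : ConvexOn ℝ univ J) : Continuous J := by
  have h := hJ.continuousOn_interior
  rwa [interior_univ, ← continuousOn_univ.symm] at h

lemma exists_combination {m M p q : ℝ} (h : p + q = m + M) (h1 : m < p) (h2 : p < M) :
    ∃ θ : ℝ, 0 < θ ∧ 0 < 1 - θ ∧ p = θ * m + (1 - θ) * M ∧ q = (1 - θ) * m + θ * M := by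
  have hM : 0 < M - m := by linarith
  refine ⟨(M - p) / (M - m), div_pos (by linarith) hM, ?_, ?_, ?_⟩
  · rw [sub_pos, div_lt_one hM]; linarith
  · field_simp; ring
  · obtain rfl : q = m + M - p := by linarith
    field_simp; ring

/-- Since the sums agree, `p` and `q` are convex combinations of `m` and `M` with exchanged weights;
adding the two convexity inequalities restores total weight one at each end. -/
lemma convexOn_add_le {J : ℝ → ℝ} (hJ : ConvexOn ℝ univ J) {m M p q : ℝ} (h : p + q = m + M)
    (h1 : m ≤ p) (h2 : p ≤ M) : J p + J q ≤ J m + J M := by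
  rcases h1.lt_or_eq with h1 | rfl
  · rcases h2.lt_or_eq with h2 | rfl
    · obtain ⟨θ, ht0, ht1, hp, hq⟩ := exists_combination h h1 h2
      have e1 := hJ.2 (mem_univ m) (mem_univ M) ht0.le ht1.le (by ring)
      have e2 := hJ.2 (mem_univ m) (mem_univ M) ht1.le ht0.le (by ring)
      simp only [smul_eq_mul] at e1 e2
      rw [hp, hq]; linarith
    · obtain rfl : q = m := by linarith
      linarith
  · obtain rfl : q = M := by linarith
    linarith

lemma strictConvexOn_add_lt {J : ℝ → ℝ} (hJ : StrictConvexOn ℝ univ J) {m M p q : ℝ}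
    (h : p + q = m + M) (h1 : m < p) (h2 : p < M) : J p + J q < J m + J M := by
  obtain ⟨θ, ht0, ht1, hp, hq⟩ := exists_combination h h1 h2
  have e1 := hJ.2 (mem_univ m) (mem_univ M) (by linarith) ht0 ht1 (by ring)
  have e2 := hJ.2 (mem_univ m) (mem_univ M) (by linarith) ht1 ht0 (by ring)
  simp only [smul_eq_mul] at e1 e2
  rw [hp, hq]; linarith

/-- The two sides differ by `(P - Q) * (K - L)`, written additively because the values may be
infinite. -/
lemma mul_add_mul_le_of_le {P Q K L : ℝ≥0∞} (h1 : Q ≤ P) (h2 : L ≤ K) :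
    Q * K + P * L ≤ P * K + Q * L := by
  obtain ⟨p, rfl⟩ := exists_add_of_le h1
  obtain ⟨κ, rfl⟩ := exists_add_of_le h2
  calc Q * (L + κ) + (Q + p) * L ≤ Q * (L + κ) + (Q + p) * L + p * κ := le_self_add
    _ = _ := by ring

lemma mul_add_mul_lt_of_lt {P Q K L : ℝ≥0∞} (hP : P ≠ ∞) (hK : K ≠ ∞) (h1 : Q < P)
    (h2 : L < K) : Q * K + P * L < P * K + Q * L := by
  have hQ := (h1.trans hP.lt_top).ne
  have hL := (h2.trans hK.lt_top).ne
  obtain ⟨p, rfl⟩ := exists_add_of_le h1.le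
  obtain ⟨κ, rfl⟩ := exists_add_of_le h2.le
  have hp : p ≠ 0 := by rintro rfl; simp at h1
  have hκ : κ ≠ 0 := by rintro rfl; simp at h2
  calc Q * (L + κ) + (Q + p) * L < Q * (L + κ) + (Q + p) * L + p * κ := by
        refine ENNReal.lt_add_right ?_ (mul_ne_zero hp hκ)
        exact ENNReal.add_ne_top.2 ⟨ENNReal.mul_ne_top hQ hK, ENNReal.mul_ne_top hP hL⟩
    _ = _ := by ring

/-- The symmetrized two-point energy of the values `a, a'` and `b, b'` at two pairs of reflected
points. -/
def quad (J : ℝ → ℝ) (K L : ℝ≥0∞) (a a' b b' : ℝ) : ℝ≥0∞ :=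
  (ENNReal.ofReal (J (a - b)) + ENNReal.ofReal (J (a' - b'))) * K +
    (ENNReal.ofReal (J (a - b')) + ENNReal.ofReal (J (a' - b))) * L

/-- If both pairs are ordered alike, nothing changes up to reordering. Otherwise polarization
exchanges one pair, which moves the larger of the two sums of `J`-values from the larger weight `K`
to the smaller weight `L`. -/
lemma quad_max_min_le {J : ℝ → ℝ} (hJ : ConvexOn ℝ univ J) (hJ0 : ∀ t, 0 ≤ J t) {K L : ℝ≥0∞}
    (h : L ≤ K) (a a' b b' : ℝ) :
    quad J K L (max a a') (min a a') (max b b') (min b b') ≤ quad J K L a a' b b' := by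
  unfold quad
  rcases le_total a a' with h1 | h1 <;> rcases le_total b b' with h2 | h2 <;>
    simp only [max_eq_left, max_eq_right, min_eq_left, min_eq_right, h1, h2]
  · exact le_of_eq (by ring)
  · rw [add_comm (ENNReal.ofReal (J (a' - b))),
      add_comm (ENNReal.ofReal (J (a' - b')))]
    refine mul_add_mul_le_of_le ?_ h
    rw [← ENNReal.ofReal_add (hJ0 _) (hJ0 _), ← ENNReal.ofReal_add (hJ0 _) (hJ0 _)]
    exact ENNReal.ofReal_le_ofReal (convexOn_add_le hJ (by ring) (by linarith) (by linarith))
  · refine mul_add_mul_le_of_le ?_ h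
    rw [← ENNReal.ofReal_add (hJ0 _) (hJ0 _), ← ENNReal.ofReal_add (hJ0 _) (hJ0 _),
      add_comm (J (a - b))]
    exact ENNReal.ofReal_le_ofReal (convexOn_add_le hJ (by ring) (by linarith) (by linarith))
  · exact le_rfl

lemma quad_max_min_lt {J : ℝ → ℝ} (hJ : StrictConvexOn ℝ univ J) (hJ0 : ∀ t, 0 ≤ J t)
    {K L : ℝ≥0∞} (hK : K ≠ ∞) (h : L < K) {a a' b b' : ℝ} (h1 : a' < a) (h2 : b < b') :
    quad J K L (max a a') (min a a') (max b b') (min b b') < quad J K L a a' b b' := by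
  unfold quad
  simp only [max_eq_left h1.le, max_eq_right h2.le, min_eq_right h1.le, min_eq_left h2.le]
  refine mul_add_mul_lt_of_lt (by simp) hK ?_ h
  rw [← ENNReal.ofReal_add (hJ0 _) (hJ0 _), ← ENNReal.ofReal_add (hJ0 _) (hJ0 _),
    add_comm (J (a - b))]
  have := strictConvexOn_add_lt hJ (m := a' - b') (M := a - b) (p := a - b') (q := a' - b)
    (by ring) (by linarith) (by linarith)
  exact (ENNReal.ofReal_lt_ofReal_iff_of_nonneg (add_nonneg (hJ0 _) (hJ0 _))).2 this

/-! ### The energy does not increase under polarization -/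

/-- The integrand of the energy. -/
def dens (J : ℝ → ℝ) (k : Sp N → ℝ≥0∞) (u : Sp N → ℝ) (z : Sp N × Sp N) : ℝ≥0∞ :=
  ENNReal.ofReal (J (u z.1 - u z.2)) * k (z.1 - z.2)

lemma measurable_dens {J : ℝ → ℝ} (hJ : Measurable J) {k : Sp N → ℝ≥0∞} (hk : Measurable k)
    {u : Sp N → ℝ} (hu : Measurable u) : Measurable (dens J k u) := by
  unfold dens; fun_prop

lemma energy_eq_lintegral_dens {J : ℝ → ℝ} (hJ : Measurable J) {k : Sp N → ℝ≥0∞}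
    (hk : Measurable k) {u : Sp N → ℝ} (hu : Measurable u) :
    energy J k u = ∫⁻ z, dens J k u z ∂(volume.prod volume) := by
  rw [lintegral_prod _ (measurable_dens hJ hk hu).aemeasurable]
  rfl

/-- The sum of the integrand of the energy over the four pairs of reflected points. -/
def symmDens (J : ℝ → ℝ) (k : Sp N → ℝ≥0∞) (e : Sp N) (s : ℝ) (u : Sp N → ℝ)
    (z : Sp N × Sp N) : ℝ≥0∞ :=
  dens J k u z + dens J k u (refl e s z.1, refl e s z.2) + dens J k u (z.1, refl e s z.2) +
    dens J k u (refl e s z.1, z.2)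

lemma measurable_symmDens {J : ℝ → ℝ} (hJ : Measurable J) {k : Sp N → ℝ≥0∞} (hk : Measurable k)
    (e : Sp N) (s : ℝ) {u : Sp N → ℝ} (hu : Measurable u) :
    Measurable (symmDens J k e s u) := by
  have h := measurable_dens hJ hk hu
  have h1 : Measurable fun z : Sp N × Sp N => refl e s z.1 := (measurable_refl e s).comp measurable_fst
  have h2 : Measurable fun z : Sp N × Sp N => refl e s z.2 := (measurable_refl e s).comp measurable_snd
  exact ((h.add (h.comp (h1.prodMk h2))).add (h.comp (measurable_fst.prodMk h2))).add
    (h.comp (h1.prodMk measurable_snd))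

/-- Reflecting either variable preserves the product measure, so the four summands have the same
integral. -/
lemma lintegral_symmDens {J : ℝ → ℝ} (hJ : Measurable J) {k : Sp N → ℝ≥0∞} (hk : Measurable k)
    {e : Sp N} (he : ‖e‖ = 1) (s : ℝ) {u : Sp N → ℝ} (hu : Measurable u) :
    ∫⁻ z, symmDens J k e s u z ∂(volume.prod volume) = 4 * energy J k u := by
  have h := measurable_dens hJ hk hu
  have hσ := measurePreserving_refl he s
  have hid := MeasurePreserving.id (volume : Measure (Sp N))
  have m1 := hσ.prod hσ
  have m2 := hid.prod hσ
  have m3 := hσ.prod hid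
  have e1 := m1.lintegral_comp h
  have e2 := m2.lintegral_comp h
  have e3 := m3.lintegral_comp h
  have i1 := h.comp m1.measurable
  have i2 := h.comp m2.measurable
  rw [energy_eq_lintegral_dens hJ hk hu]
  calc ∫⁻ z, symmDens J k e s u z ∂(volume.prod volume)
      = ∫⁻ z, (dens J k u z + dens J k u (Prod.map (refl e s) (refl e s) z)
          + dens J k u (Prod.map id (refl e s) z)
          + dens J k u (Prod.map (refl e s) id z)) ∂(volume.prod volume) := rfl
    _ = _ := by
      rw [lintegral_add_left, lintegral_add_left, lintegral_add_left h, e1, e2, e3]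
      · ring
      · exact h.add i1
      · exact (h.add i1).add i2

/-- Reflections are isometries, so the radial kernel takes only two values on the four pairs. -/
lemma symmDens_eq_quad {J : ℝ → ℝ} {k : Sp N → ℝ≥0∞} (hk : IsSymmDecreasing k)
    {e : Sp N} (he : ‖e‖ = 1) (s : ℝ) (u : Sp N → ℝ) (x y : Sp N) :
    symmDens J k e s u (x, y) = quad J (k (x - y)) (k (x - refl e s y)) (u x) (u (refl e s x))
      (u y) (u (refl e s y)) := by
  simp only [symmDens, dens, quad]
  rw [hk.norm_congr (norm_refl_sub_refl he s x y), hk.norm_congr (norm_sub_refl_comm he s x y)]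
  ring

lemma symmDens_refl_left {J : ℝ → ℝ} {k : Sp N → ℝ≥0∞} {e : Sp N} (he : ‖e‖ = 1) (s : ℝ)
    (u : Sp N → ℝ) (x y : Sp N) :
    symmDens J k e s u (refl e s x, y) = symmDens J k e s u (x, y) := by
  simp only [symmDens, refl_refl he]
  ring

lemma symmDens_refl_right {J : ℝ → ℝ} {k : Sp N → ℝ≥0∞} {e : Sp N} (he : ‖e‖ = 1) (s : ℝ)
    (u : Sp N → ℝ) (x y : Sp N) :
    symmDens J k e s u (x, refl e s y) = symmDens J k e s u (x, y) := by
  simp only [symmDens, refl_refl he]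
  ring

lemma norm_sub_le_norm_sub_refl {e : Sp N} (he : ‖e‖ = 1) {s : ℝ} {x y : Sp N}
    (hx : inner ℝ x e ≤ s) (hy : inner ℝ y e ≤ s) : ‖x - y‖ ≤ ‖x - refl e s y‖ := by
  rw [← sq_le_sq₀ (norm_nonneg _) (norm_nonneg _), norm_sub_refl_sq he]
  nlinarith [mul_nonneg (sub_nonneg.2 hx) (sub_nonneg.2 hy)]

lemma norm_sub_lt_norm_sub_refl {e : Sp N} (he : ‖e‖ = 1) {s : ℝ} {x y : Sp N}
    (hx : inner ℝ x e < s) (hy : inner ℝ y e < s) : ‖x - y‖ < ‖x - refl e s y‖ := by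
  rw [← sq_lt_sq₀ (norm_nonneg _) (norm_nonneg _), norm_sub_refl_sq he]
  nlinarith [mul_pos (sub_pos.2 hx) (sub_pos.2 hy)]

lemma pol_eq_max {e : Sp N} {s : ℝ} {u : Sp N → ℝ} {x : Sp N} (hx : inner ℝ x e ≤ s) :
    pol e s u x = max (u x) (u (refl e s x)) := by
  rcases hx.lt_or_eq with hx | hx
  · exact pol_of_lt hx
  · rw [pol_of_eq hx, refl_of_inner_eq hx, max_self]

lemma pol_refl_eq_min {e : Sp N} (he : ‖e‖ = 1) {s : ℝ} {u : Sp N → ℝ} {x : Sp N}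
    (hx : inner ℝ x e ≤ s) : pol e s u (refl e s x) = min (u x) (u (refl e s x)) := by
  rcases hx.lt_or_eq with hx | hx
  · exact pol_refl_of_lt he hx
  · rw [refl_of_inner_eq hx, pol_of_eq hx, min_self]

lemma symmDens_pol_le {J : ℝ → ℝ} (hJ : ConvexOn ℝ univ J) (hJ0 : ∀ t, 0 ≤ J t)
    {k : Sp N → ℝ≥0∞} (hk : IsSymmDecreasing k) {e : Sp N} (he : ‖e‖ = 1) (s : ℝ)
    (u : Sp N → ℝ) (x y : Sp N) :
    symmDens J k e s (pol e s u) (x, y) ≤ symmDens J k e s u (x, y) := by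
  revert x
  refine forall_of_half he s (fun x hx => ?_)
    (fun x h => by rwa [symmDens_refl_left he, symmDens_refl_left he] at h)
  revert y
  refine forall_of_half he s (fun y hy => ?_)
    (fun y h => by rwa [symmDens_refl_right he, symmDens_refl_right he] at h)
  rw [symmDens_eq_quad hk he, symmDens_eq_quad hk he, pol_eq_max hx, pol_eq_max hy,
    pol_refl_eq_min he hx, pol_refl_eq_min he hy]
  exact quad_max_min_le hJ hJ0 (hk _ _ (norm_sub_le_norm_sub_refl he hx hy)) _ _ _ _

theorem energy_pol_le {J : ℝ → ℝ} (hJ : ConvexOn ℝ univ J) (hJ0 : ∀ t, 0 ≤ J t)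
    {k : Sp N → ℝ≥0∞} (hk : IsSymmDecreasing k) (hkm : Measurable k) {e : Sp N} (he : ‖e‖ = 1)
    (s : ℝ) {u : Sp N → ℝ} (hu : Measurable u) :
    energy J k (pol e s u) ≤ energy J k u := by
  have hJm := (continuous_of_convexOn_univ hJ).measurable
  have h : 4 * energy J k (pol e s u) ≤ 4 * energy J k u := by
    rw [← lintegral_symmDens hJm hkm he s hu,
      ← lintegral_symmDens hJm hkm he s (measurable_pol e s hu)]
    exact lintegral_mono fun z => symmDens_pol_le hJ hJ0 hk he s u z.1 z.2
  exact (ENNReal.mul_le_mul_iff_right (by norm_num) (by norm_num)).1 h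

/-- If polarization preserves the finite energy, then `u` is ordered with respect to the
reflection. -/
theorem ordered_of_energy_pol_eq {J : ℝ → ℝ} (hJ : StrictConvexOn ℝ univ J) (hJ0 : ∀ t, 0 ≤ J t)
    {k : Sp N → ℝ≥0∞} (hk : IsStrictSymmDecreasing k) (hkm : Measurable k) {e : Sp N}
    (he : ‖e‖ = 1) (s : ℝ) {u : Sp N → ℝ} (hu : Measurable u) (hfin : energy J k u ≠ ∞)
    (heq : energy J k (pol e s u) = energy J k u) :
    (∀ᵐ x, inner ℝ x e < s → u (refl e s x) ≤ u x) ∨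
      (∀ᵐ x, inner ℝ x e < s → u x ≤ u (refl e s x)) := by
  have hJm := (continuous_of_convexOn_univ hJ.convexOn).measurable
  have h1 := lintegral_symmDens hJm hkm he s hu
  have h2 := lintegral_symmDens hJm hkm he s (measurable_pol e s hu)
  have hle : ∀ z, symmDens J k e s (pol e s u) z ≤ symmDens J k e s u z := fun z =>
    symmDens_pol_le hJ.convexOn hJ0 hk.1 he s u z.1 z.2
  have hae : symmDens J k e s (pol e s u) =ᵐ[volume.prod volume] symmDens J k e s u := by
    refine ae_eq_of_ae_le_of_lintegral_le (Filter.Eventually.of_forall hle) ?_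
      (measurable_symmDens hJm hkm e s hu).aemeasurable ?_
    · rw [h2, heq]; exact ENNReal.mul_ne_top (by norm_num) hfin
    · rw [h1, h2, heq]
  -- On `A ×ˢ B` the values of `u` are strictly ordered in opposite ways at `x` and `y`, so the
  -- symmetrized density drops strictly. Equality of the integrals makes this product null, hence
  -- one of the factors.
  set A : Set (Sp N) := {x | inner ℝ x e < s ∧ u (refl e s x) < u x}
  set B : Set (Sp N) := {x | inner ℝ x e < s ∧ u x < u (refl e s x)}
  have hAB : (volume.prod volume) (A ×ˢ B) = 0 := by
    refine measure_mono_null ?_ (ae_iff.1 hae)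
    rintro ⟨x, y⟩ ⟨⟨hx, hx'⟩, ⟨hy, hy'⟩⟩
    refine ne_of_lt ?_
    rw [symmDens_eq_quad hk.1 he, symmDens_eq_quad hk.1 he, pol_eq_max hx.le, pol_eq_max hy.le,
      pol_refl_eq_min he hx.le, pol_refl_eq_min he hy.le]
    refine quad_max_min_lt hJ hJ0 ?_ (hk.2 _ _ (norm_sub_lt_norm_sub_refl he hx hy)) hx' hy'
    -- The kernel may be infinite at the origin only: away from it, strict decrease bounds it
    -- strictly by its value at `0`.
    have hxy : x ≠ y := by rintro rfl; exact lt_asymm hx' hy'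
    have := hk.2 0 (x - y) (by simpa [sub_eq_zero] using hxy)
    exact (this.trans_le le_top).ne
  rw [Measure.prod_prod, mul_eq_zero] at hAB
  refine hAB.symm.imp (fun h => ?_) (fun h => ?_)
  · filter_upwards [measure_eq_zero_iff_ae_notMem.1 h] with x hx hxs
    by_contra hlt
    exact hx ⟨hxs, not_le.1 hlt⟩
  · filter_upwards [measure_eq_zero_iff_ae_notMem.1 h] with x hx hxs
    by_contra hlt
    exact hx ⟨hxs, not_le.1 hlt⟩

/-! ### Symmetric decreasing rearrangements -/

/-- The radius of `setRearr A`. -/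
def rad (A : Set (Sp N)) : ℝ :=
  ((volume A).toReal / (volume (Metric.ball (0 : Sp N) 1)).toReal) ^ ((1 : ℝ) / (N : ℝ))

lemma mem_setRearr {A : Set (Sp N)} {x : Sp N} : x ∈ setRearr A ↔ ‖x‖ < rad A := by
  simp [setRearr, rad]

lemma rad_nonneg (A : Set (Sp N)) : 0 ≤ rad A := by unfold rad; positivity

lemma rad_congr {A B : Set (Sp N)} (h : volume A = volume B) : rad A = rad B := by
  simp only [rad, h]

lemma setRearr_congr {A B : Set (Sp N)} (h : volume A = volume B) : setRearr A = setRearr B := by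
  ext x; rw [mem_setRearr, mem_setRearr, rad_congr h]

lemma measurableSet_setRearr (A : Set (Sp N)) : MeasurableSet (setRearr A) :=
  Metric.isOpen_ball.measurableSet

lemma volume_unit_ball_toReal_pos : 0 < (volume (Metric.ball (0 : Sp N) 1)).toReal :=
  ENNReal.toReal_pos (Metric.measure_ball_pos _ _ one_pos).ne' measure_ball_lt_top.ne

lemma volume_ball_eq (hN : 1 ≤ N) (x : Sp N) {r : ℝ} (hr : 0 ≤ r) :
    volume (Metric.ball x r) = ENNReal.ofReal (r ^ N) * volume (Metric.ball (0 : Sp N) 1) := by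
  have : Nonempty (Fin N) := ⟨⟨0, hN⟩⟩
  rw [Measure.addHaar_ball volume x hr, finrank_euclideanSpace_fin]

lemma volume_setRearr (hN : 1 ≤ N) {A : Set (Sp N)} (hA : volume A ≠ ∞) :
    volume (setRearr A) = volume A := by
  have hb := volume_unit_ball_toReal_pos (N := N)
  have h1 : rad A ^ N = (volume A).toReal / (volume (Metric.ball (0 : Sp N) 1)).toReal := by
    rw [rad, one_div, Real.rpow_inv_natCast_pow (by positivity) (by omega)]
  change volume (Metric.ball 0 (rad A)) = _
  rw [volume_ball_eq hN _ (rad_nonneg A), h1, ENNReal.ofReal_div_of_pos hb,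
    ENNReal.ofReal_toReal hA, ENNReal.ofReal_toReal measure_ball_lt_top.ne]
  exact ENNReal.div_mul_cancel (Metric.measure_ball_pos _ _ one_pos).ne' measure_ball_lt_top.ne

lemma rad_mono {A B : Set (Sp N)} (h : volume A ≤ volume B) (hB : volume B ≠ ∞) :
    rad A ≤ rad B := by
  unfold rad
  have := ENNReal.toReal_mono hB h
  gcongr

lemma tendsto_rad {ι : Type*} {l : Filter ι} {A : ι → Set (Sp N)} {m : ℝ≥0∞}
    (hm : m ≠ ∞) (h : Filter.Tendsto (fun i => volume (A i)) l (nhds m)) :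
    Filter.Tendsto (fun i => rad (A i)) l
      (nhds ((m.toReal / (volume (Metric.ball (0 : Sp N) 1)).toReal) ^ ((1 : ℝ) / (N : ℝ)))) :=
  (((ENNReal.tendsto_toReal hm).comp h).div_const _).rpow_const (Or.inr (by positivity))

/-- The radii converge, and the balls are open, so the strict inequality `‖x‖ < rad` already holds
at some finite stage. -/
lemma exists_mem_setRearr_of_iUnion {A : ℕ → Set (Sp N)} (hmono : Monotone A)
    (hfin : volume (⋃ n, A n) ≠ ∞) {x : Sp N} (hx : x ∈ setRearr (⋃ n, A n)) :
    ∃ n, x ∈ setRearr (A n) := by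
  have h := tendsto_rad hfin (tendsto_measure_iUnion_atTop hmono (μ := volume))
  obtain ⟨n, hn⟩ := (h.eventually (lt_mem_nhds (mem_setRearr.1 hx))).exists
  exact ⟨n, mem_setRearr.2 hn⟩

lemma setRearr_mono {A B : Set (Sp N)} (h : A ⊆ B) (hB : volume B ≠ ∞) :
    setRearr A ⊆ setRearr B := fun _ hx =>
  mem_setRearr.2 ((mem_setRearr.1 hx).trans_le (rad_mono (measure_mono h) hB))

lemma exists_gt_mem_setRearr {u : Sp N → ℝ}
    (hlev : ∀ τ : ℝ, 0 < τ → volume {x | τ < u x} < ∞) {t : ℝ} (ht : 0 < t) {x : Sp N}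
    (hx : x ∈ setRearr {y | t < u y}) : ∃ t', t < t' ∧ x ∈ setRearr {y | t' < u y} := by
  have hU : {y | t < u y} = ⋃ n : ℕ, {y | t + 1 / ((n : ℝ) + 1) < u y} := by
    ext y
    simp only [mem_ofPred_eq, mem_iUnion]
    constructor
    · intro h
      obtain ⟨n, hn⟩ := exists_nat_one_div_lt (sub_pos.2 h)
      exact ⟨n, by linarith⟩
    · rintro ⟨n, hn⟩
      have : (0 : ℝ) < 1 / ((n : ℝ) + 1) := by positivity
      linarith
  have hfin := (hlev t ht).ne
  rw [hU] at hx hfin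
  obtain ⟨n, hn⟩ := exists_mem_setRearr_of_iUnion (fun a b hab y hy => by
    have := one_div_le_one_div_of_le (by positivity : (0 : ℝ) < (a : ℝ) + 1)
      (by exact_mod_cast Nat.succ_le_succ hab : (a : ℝ) + 1 ≤ (b : ℝ) + 1)
    have hy' : t + 1 / ((a : ℝ) + 1) < u y := hy
    show t + 1 / ((b : ℝ) + 1) < u y
    linarith) hfin hx
  exact ⟨_, lt_add_of_pos_right t (by positivity), hn⟩

lemma antitone_level_setRearr {u : Sp N → ℝ}
    (hlev : ∀ τ : ℝ, 0 < τ → volume {x | τ < u x} < ∞) {t t' : ℝ} (ht : 0 < t) (h : t ≤ t') :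
    setRearr {y | t' < u y} ⊆ setRearr {y | t < u y} :=
  setRearr_mono (fun _ hy => h.trans_lt hy) (hlev t ht).ne

/-- The levels `t > 0` whose ball contains `x` form an initial interval of `(0, ∞)` without a
largest element (`exists_gt_mem_setRearr`), and `rearr u x` is its length. -/
lemma lt_rearr_iff {u : Sp N → ℝ}
    (hlev : ∀ τ : ℝ, 0 < τ → volume {x | τ < u x} < ∞) {t : ℝ} (ht : 0 < t) (x : Sp N) :
    ENNReal.ofReal t < rearr u x ↔ x ∈ setRearr {y | t < u y} := by
  constructor
  · intro h
    by_contra hx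
    refine h.not_ge ?_
    calc rearr u x ≤ ∫⁻ t' in Ioi (0 : ℝ), (Ioo 0 t).indicator 1 t' := by
          refine setLIntegral_mono (measurable_one.indicator measurableSet_Ioo) fun t' ht' => ?_
          by_cases hx' : x ∈ setRearr {y | t' < u y}
          · have : t' < t := by
              by_contra hc
              exact hx (antitone_level_setRearr hlev ht (not_lt.1 hc) hx')
            rw [indicator_of_mem hx', indicator_of_mem (show t' ∈ Ioo 0 t from ⟨ht', this⟩)]
            rfl
          · rw [indicator_of_notMem hx']; exact zero_le
      _ ≤ ∫⁻ t', (Ioo 0 t).indicator 1 t' := setLIntegral_le_lintegral _ _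
      _ = ENNReal.ofReal t := by
          rw [lintegral_indicator_one measurableSet_Ioo, Real.volume_Ioo, sub_zero]
  · intro hx
    obtain ⟨t', htt, hx'⟩ := exists_gt_mem_setRearr hlev ht hx
    calc ENNReal.ofReal t < ENNReal.ofReal t' :=
          (ENNReal.ofReal_lt_ofReal_iff (ht.trans htt)).2 htt
      _ = ∫⁻ s, (Ioc 0 t').indicator 1 s := by
          rw [lintegral_indicator_one measurableSet_Ioc, Real.volume_Ioc, sub_zero]
      _ = ∫⁻ s in Ioi (0 : ℝ), (Ioc 0 t').indicator 1 s := by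
          rw [← lintegral_indicator measurableSet_Ioi, indicator_indicator,
            inter_eq_right.2 Ioc_subset_Ioi_self]
      _ ≤ rearr u x := by
          refine setLIntegral_mono' measurableSet_Ioi fun s hs => ?_
          by_cases hst : s ∈ Ioc 0 t'
          · rw [indicator_of_mem hst, indicator_of_mem
              (antitone_level_setRearr hlev hst.1 hst.2 hx')]
            rfl
          · rw [indicator_of_notMem hst]; exact zero_le

lemma isSymmDecreasing_rearr (u : Sp N → ℝ) : IsSymmDecreasing (rearr u) := by
  intro x y hxy
  refine lintegral_mono fun t => ?_
  by_cases hy : y ∈ setRearr {z | t < u z}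
  · rw [indicator_of_mem hy, indicator_of_mem]
    exact mem_setRearr.2 (hxy.trans_lt (mem_setRearr.1 hy))
  · rw [indicator_of_notMem hy]; exact zero_le

lemma rearr_congr {u v : Sp N → ℝ} (h : ∀ t : ℝ, 0 < t → volume {x | t < u x} = volume {x | t < v x}) :
    rearr u = rearr v := by
  ext x
  refine setLIntegral_congr_fun measurableSet_Ioi fun t ht => ?_
  rw [setRearr_congr (h t ht)]

/-- The level sets decrease to the empty set, so their radii eventually fall below `‖x‖`. -/
lemma rearr_lt_top (hN : 1 ≤ N) {u : Sp N → ℝ} (hu : Measurable u)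
    (hlev : ∀ τ : ℝ, 0 < τ → volume {x | τ < u x} < ∞) {x : Sp N} (hx : x ≠ 0) :
    rearr u x < ∞ := by
  have h0 : Filter.Tendsto (fun n : ℕ => volume {y | (n : ℝ) + 1 < u y}) Filter.atTop
      (nhds 0) := by
    have h := tendsto_measure_iInter_atTop (μ := volume) (s := fun n : ℕ => {y | (n : ℝ) + 1 < u y})
      (fun n => (measurableSet_lt measurable_const hu).nullMeasurableSet)
      (fun a b hab y (hy : (b : ℝ) + 1 < u y) =>
        lt_of_le_of_lt (by simpa using hab : (a : ℝ) + 1 ≤ b + 1) hy)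
      ⟨0, (hlev _ (by positivity)).ne⟩
    have h2 : ⋂ n : ℕ, {y | (n : ℝ) + 1 < u y} = ∅ := by
      rw [eq_empty_iff_forall_notMem]
      intro y hy
      obtain ⟨n, hn⟩ := exists_nat_gt (u y)
      have : (n : ℝ) + 1 < u y := mem_iInter.1 hy n
      linarith
    rwa [h2, measure_empty] at h
  have h1 := tendsto_rad ENNReal.zero_ne_top h0
  rw [ENNReal.toReal_zero, zero_div, Real.zero_rpow (by positivity)] at h1
  obtain ⟨n, hn⟩ := (h1.eventually (gt_mem_nhds (norm_pos_iff.2 hx))).exists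
  have hpos : (0 : ℝ) < n + 1 := by positivity
  have h3 := (lt_rearr_iff hlev hpos x).not.2 (fun h => lt_asymm hn (mem_setRearr.1 h))
  exact (not_lt.1 h3).trans_lt ENNReal.ofReal_lt_top

lemma rearrReal_nonneg (u : Sp N → ℝ) (x : Sp N) : 0 ≤ rearrReal u x := ENNReal.toReal_nonneg

lemma measurable_rearrReal (hN : 1 ≤ N) (u : Sp N → ℝ) : Measurable (rearrReal u) :=
  ((isSymmDecreasing_rearr u).measurable hN).ennreal_toReal

lemma lt_rearrReal_iff (hN : 1 ≤ N) {u : Sp N → ℝ} (hu : Measurable u)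
    (hlev : ∀ τ : ℝ, 0 < τ → volume {x | τ < u x} < ∞) {t : ℝ} (ht : 0 < t) {x : Sp N}
    (hx : x ≠ 0) : t < rearrReal u x ↔ x ∈ setRearr {y | t < u y} := by
  rw [← lt_rearr_iff hlev ht, rearrReal, ENNReal.ofReal_lt_iff_lt_toReal ht.le
    (rearr_lt_top hN hu hlev hx).ne]

lemma ae_ne_zero (hN : 1 ≤ N) : ∀ᵐ x : Sp N, x ≠ 0 := by
  have : Nonempty (Fin N) := ⟨⟨0, hN⟩⟩
  exact Measure.ae_ne volume 0

lemma level_rearrReal_ae_eq (hN : 1 ≤ N) {u : Sp N → ℝ} (hu : Measurable u)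
    (hlev : ∀ τ : ℝ, 0 < τ → volume {x | τ < u x} < ∞) {t : ℝ} (ht : 0 < t) :
    {x | t < rearrReal u x} =ᵐ[volume] setRearr {y | t < u y} := by
  filter_upwards [ae_ne_zero hN] with x hx
  exact propext (lt_rearrReal_iff hN hu hlev ht hx)

lemma volume_level_rearrReal (hN : 1 ≤ N) {u : Sp N → ℝ} (hu : Measurable u)
    (hlev : ∀ τ : ℝ, 0 < τ → volume {x | τ < u x} < ∞) {t : ℝ} (ht : 0 < t) :
    volume {x | t < rearrReal u x} = volume {y | t < u y} := by
  rw [measure_congr (level_rearrReal_ae_eq hN hu hlev ht), volume_setRearr hN (hlev t ht).ne]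

/-- `a ≤ b` if every positive number below `a` is below `b`, for `b ≥ 0`. -/
lemma le_of_forall_pos_lt {a b : ℝ} (hb : 0 ≤ b) (h : ∀ t, 0 < t → t < a → t < b) : a ≤ b := by
  by_contra hc
  push Not at hc
  have := h ((a + b) / 2) (by linarith) (by linarith)
  linarith

/-- For an increasing sequence the level sets at a fixed height exhaust the level set of the limit,
so the corresponding balls do too. -/
lemma rearrReal_tendsto_of_monotone (hN : 1 ≤ N) {u : Sp N → ℝ} {w : ℕ → Sp N → ℝ}
    (hu : Measurable u) (hw : ∀ n, Measurable (w n))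
    (hlev : ∀ τ : ℝ, 0 < τ → volume {x | τ < u x} < ∞) (hmono : Monotone w)
    (hlim : ∀ x, Filter.Tendsto (fun n => w n x) Filter.atTop (nhds (u x))) {x : Sp N}
    (hx : x ≠ 0) :
    Filter.Tendsto (fun n => rearrReal (w n) x) Filter.atTop (nhds (rearrReal u x)) := by
  have hle : ∀ n y, w n y ≤ u y := fun n y =>
    Monotone.ge_of_tendsto (f := fun n => w n y) (fun a b hab => hmono hab y) (hlim y) n
  have hsub : ∀ n t, {y | t < w n y} ⊆ {y | t < u y} := fun n t y hy => lt_of_lt_of_le hy (hle n y)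
  have hlevw : ∀ n, ∀ τ : ℝ, 0 < τ → volume {x | τ < w n x} < ∞ := fun n τ hτ =>
    (measure_mono (hsub n τ)).trans_lt (hlev τ hτ)
  have hub : ∀ n, rearrReal (w n) x ≤ rearrReal u x := fun n =>
    le_of_forall_pos_lt (rearrReal_nonneg _ _) fun t ht h => by
      rw [lt_rearrReal_iff hN (hw n) (hlevw n) ht hx] at h
      rw [lt_rearrReal_iff hN hu hlev ht hx]
      exact setRearr_mono (hsub n t) (hlev t ht).ne h
  refine tendsto_order.2 ⟨fun a ha => ?_, fun a ha =>
    Filter.Eventually.of_forall fun n => (hub n).trans_lt ha⟩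
  rcases lt_or_ge a 0 with ha0 | ha0
  · exact Filter.Eventually.of_forall fun n => ha0.trans_le (rearrReal_nonneg _ _)
  obtain ⟨t, hat, ht⟩ := exists_between ha
  have ht0 : 0 < t := ha0.trans_lt hat
  rw [lt_rearrReal_iff hN hu hlev ht0 hx] at ht
  have hU : {y | t < u y} = ⋃ n, {y | t < w n y} := by
    refine Subset.antisymm (fun y hy => ?_) (iUnion_subset fun n => hsub n t)
    obtain ⟨n, hn⟩ := ((hlim y).eventually (lt_mem_nhds hy)).exists
    exact mem_iUnion.2 ⟨n, hn⟩
  have hfin := (hlev t ht0).ne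
  rw [hU] at ht hfin
  have hm : Monotone fun n => {y | t < w n y} := fun a b hab y (hy : t < w a y) =>
    lt_of_lt_of_le hy (hmono hab y)
  obtain ⟨n, hn⟩ := exists_mem_setRearr_of_iUnion hm hfin ht
  filter_upwards [Filter.eventually_ge_atTop n] with m hm'
  refine hat.trans ?_
  rw [lt_rearrReal_iff hN (hw m) (hlevw m) ht0 hx]
  exact setRearr_mono (hm hm') (hlevw m t ht0).ne hn

/-- Functions with almost everywhere equal positive level sets agree almost everywhere. -/
lemma ae_eq_of_level_ae_eq {f g : Sp N → ℝ} (hf : ∀ x, 0 ≤ f x) (hg : ∀ x, 0 ≤ g x)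
    (h : ∀ t : ℝ, 0 < t → {x | t < f x} =ᵐ[volume] {x | t < g x}) : f =ᵐ[volume] g := by
  have h1 : ∀ᵐ x, ∀ q : ℚ, 0 < (q : ℝ) → ((q : ℝ) < f x ↔ (q : ℝ) < g x) := by
    rw [ae_all_iff]
    intro q
    by_cases hq : 0 < (q : ℝ)
    · filter_upwards [h q hq] with x hx _
      exact iff_of_eq hx
    · exact Filter.Eventually.of_forall fun x hx => absurd hx hq
  filter_upwards [h1] with x hx
  have aux : ∀ a b : ℝ, 0 ≤ b → (∀ q : ℚ, 0 < (q : ℝ) → (q : ℝ) < a → (q : ℝ) < b) → a ≤ b := by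
    intro a b hb hab
    by_contra hc
    push Not at hc
    obtain ⟨q, hq1, hq2⟩ := exists_rat_btwn hc
    exact lt_asymm hq1 (hab q (hb.trans_lt hq1) hq2)
  exact le_antisymm (aux _ _ (hg x) fun q hq => (hx q hq).1) (aux _ _ (hf x) fun q hq => (hx q hq).2)

/-! ### Averaging over reflections -/

lemma lintegral_polar (hN : 1 ≤ N) {G : Sp N → ℝ≥0∞} (hG : Measurable G) :
    ∫⁻ w, G w = ∫⁻ e : Metric.sphere (0 : Sp N) 1, ∫⁻ τ in Ioi (0 : ℝ),
      ENNReal.ofReal (τ ^ (N - 1)) * G (τ • (e : Sp N)) ∂volume ∂(volume : Measure (Sp N)).toSphere := by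
  have hae : ({(0 : Sp N)}ᶜ : Set (Sp N)) =ᵐ[volume] univ := by
    filter_upwards [ae_ne_zero hN] with x hx
    exact propext ⟨fun _ => trivial, fun _ => hx⟩
  have h0 : ∫⁻ w, G w = ∫⁻ w in ({(0 : Sp N)}ᶜ : Set (Sp N)), G w := by
    rw [setLIntegral_congr hae, setLIntegral_univ]
  have hmp := (volume : Measure (Sp N)).measurePreserving_homeomorphUnitSphereProd
  rw [finrank_euclideanSpace_fin] at hmp
  have hm : Measurable fun p : Metric.sphere (0 : Sp N) 1 × Ioi (0 : ℝ) =>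
      G ((p.2 : ℝ) • (p.1 : Sp N)) := by fun_prop
  have h1 := hmp.lintegral_comp hm
  have h2 : ∀ x : ({(0 : Sp N)}ᶜ : Set (Sp N)), G ((((homeomorphUnitSphereProd (Sp N)) x).2 : ℝ) •
      (((homeomorphUnitSphereProd (Sp N)) x).1 : Sp N)) = G x := by
    intro x
    rw [← homeomorphUnitSphereProd_symm_apply_coe, Homeomorph.symm_apply_apply]
  rw [h0, ← lintegral_subtype_comap (measurableSet_singleton _).compl]
  simp only [h2] at h1
  rw [h1, lintegral_prod _ hm.aemeasurable]
  refine lintegral_congr fun e => ?_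
  have hm2 : Measurable fun τ : ℝ => ENNReal.ofReal (τ ^ (N - 1)) * G (τ • (e : Sp N)) := by fun_prop
  rw [Measure.volumeIoiPow, lintegral_withDensity_eq_lintegral_mul _ (by fun_prop) (by fun_prop),
    ← lintegral_subtype_comap measurableSet_Ioi]
  rfl

/-- Change of variables between the offset `s` of a hyperplane and the displacement `τ = 2 * (s -
a)` of a point whose component along the normal is `a`. -/
lemma lintegral_Ioi_eq_two_mul {H : ℝ → ℝ≥0∞} (hH : Measurable H) (a : ℝ) :
    ∫⁻ τ in Ioi (0 : ℝ), H τ = 2 * ∫⁻ s in Ioi a, H (2 * (s - a)) := by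
  have hK : Measurable ((Ioi (0 : ℝ)).indicator H) := hH.indicator measurableSet_Ioi
  rw [← lintegral_indicator measurableSet_Ioi, ← lintegral_indicator measurableSet_Ioi]
  have h1 : ∀ s, (Ioi a).indicator (fun s => H (2 * (s - a))) s =
      (Ioi (0 : ℝ)).indicator H (2 * (s - a)) := by
    intro s
    by_cases hs : a < s
    · rw [indicator_of_mem (show s ∈ Ioi a from hs), indicator_of_mem]
      simpa using hs
    · rw [indicator_of_notMem (show s ∉ Ioi a from hs), indicator_of_notMem]
      simpa using hs
  simp only [h1]
  rw [lintegral_sub_right_eq_self (fun s => (Ioi (0 : ℝ)).indicator H (2 * s)) a,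
    ← lintegral_map (g := fun s : ℝ => 2 * s) hK (by fun_prop)]
  have h2 := Real.smul_map_volume_mul_left (two_ne_zero : (2 : ℝ) ≠ 0)
  conv_lhs => rw [← h2, lintegral_smul_measure]
  simp

lemma refl_eq_add (e : Sp N) (s : ℝ) (y : Sp N) :
    refl e s y = y + (2 * (s - inner ℝ y e)) • e := by
  simp only [refl]; module

/-- The reflections average to a kernel which is bounded below on bounded sets. -/
lemma lintegral_lintegral_le_reflections (hN : 1 ≤ N) {F : Sp N → Sp N → ℝ≥0∞}
    (hF : Measurable (Function.uncurry F)) {D : ℝ}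
    (hD : ∀ y x, F y x ≠ 0 → ‖x - y‖ ≤ D) :
    ∫⁻ y, ∫⁻ x, F y x ≤ ENNReal.ofReal (D ^ (N - 1)) * 2 *
      ∫⁻ e : Metric.sphere (0 : Sp N) 1, ∫⁻ s : ℝ, ∫⁻ y,
        {y : Sp N | inner ℝ y (e : Sp N) < s}.indicator (fun y => F y (refl (e : Sp N) s y)) y
        ∂volume ∂volume ∂(volume : Measure (Sp N)).toSphere := by
  set μ := (volume : Measure (Sp N)).toSphere
  let K : Sp N → Metric.sphere (0 : Sp N) 1 → ℝ → ℝ≥0∞ := fun y e s =>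
    {y : Sp N | inner ℝ y (e : Sp N) < s}.indicator (fun y => F y (refl (e : Sp N) s y)) y
  have hK : Measurable fun p : (Sp N × Metric.sphere (0 : Sp N) 1) × ℝ => K p.1.1 p.1.2 p.2 := by
    have h1 : Measurable fun p : (Sp N × Metric.sphere (0 : Sp N) 1) × ℝ =>
        F p.1.1 (refl (p.1.2 : Sp N) p.2 p.1.1) :=
      hF.comp ((measurable_fst.comp measurable_fst).prodMk
        (measurable_refl_uncurry (by fun_prop) (by fun_prop) (by fun_prop)))
    have h2 : MeasurableSet {p : (Sp N × Metric.sphere (0 : Sp N) 1) × ℝ |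
        inner ℝ p.1.1 (p.1.2 : Sp N) < p.2} := measurableSet_lt (by fun_prop) (by fun_prop)
    exact h1.indicator h2
  have step : ∀ y, ∫⁻ x, F y x ≤ ENNReal.ofReal (D ^ (N - 1)) * 2 * ∫⁻ e, ∫⁻ s, K y e s ∂volume ∂μ := by
    intro y
    have hFy : Measurable (F y) := hF.comp (measurable_const.prodMk measurable_id)
    -- Polar coordinates around `y`: the point `y + τ • e` is the mirror image of `y` in the
    -- hyperplane with normal `e` and offset `⟪y, e⟫ + τ / 2`. The factor 2 is the Jacobian of this
    -- substitution, and `τ ^ (N - 1) ≤ D ^ (N - 1)` wherever `F` is nonzero.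
    rw [← lintegral_add_left_eq_self (F y) y,
      lintegral_polar hN (G := fun x => F y (y + x)) (hFy.comp (measurable_const_add y)),
      mul_assoc, ← lintegral_const_mul' _ _ (by norm_num),
      ← lintegral_const_mul' _ _ ENNReal.ofReal_ne_top]
    refine lintegral_mono fun e => ?_
    have he : ‖(e : Sp N)‖ = 1 := by simp
    have hH : Measurable fun τ : ℝ => F y (y + τ • (e : Sp N)) := hFy.comp (by fun_prop)
    have hs := lintegral_Ioi_eq_two_mul hH (inner ℝ y (e : Sp N))
    simp only [← refl_eq_add] at hs
    have hs' : ∫⁻ s, K y e s = ∫⁻ s in Ioi (inner ℝ y (e : Sp N)), F y (refl (e : Sp N) s y) := by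
      rw [← lintegral_indicator measurableSet_Ioi]
      rfl
    simp only [hs']
    rw [← hs, ← lintegral_const_mul' _ _ ENNReal.ofReal_ne_top]
    refine setLIntegral_mono' measurableSet_Ioi fun τ hτ => ?_
    by_cases h0 : F y (y + τ • (e : Sp N)) = 0
    · simp only [h0, mul_zero]; exact zero_le
    · have := hD _ _ h0
      rw [add_sub_cancel_left, norm_smul, he, mul_one, Real.norm_of_nonneg (le_of_lt hτ)] at this
      have hτ' : (0 : ℝ) ≤ τ := le_of_lt hτ
      exact mul_le_mul_left (ENNReal.ofReal_le_ofReal (by gcongr)) _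
  calc ∫⁻ y, ∫⁻ x, F y x
      ≤ ∫⁻ y, ENNReal.ofReal (D ^ (N - 1)) * 2 * ∫⁻ e, ∫⁻ s, K y e s ∂volume ∂μ :=
        lintegral_mono step
    _ = ENNReal.ofReal (D ^ (N - 1)) * 2 * ∫⁻ y, ∫⁻ e, ∫⁻ s, K y e s ∂volume ∂μ :=
        lintegral_const_mul' _ _ (ENNReal.mul_ne_top ENNReal.ofReal_ne_top (by norm_num))
    _ = ENNReal.ofReal (D ^ (N - 1)) * 2 * ∫⁻ e, ∫⁻ y, ∫⁻ s, K y e s ∂volume ∂volume ∂μ := by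
        rw [lintegral_lintegral_swap]
        exact (hK.lintegral_prod_right').aemeasurable
    _ = ENNReal.ofReal (D ^ (N - 1)) * 2 * ∫⁻ e, ∫⁻ s, ∫⁻ y, K y e s ∂volume ∂volume ∂μ := by
        congr 1
        refine lintegral_congr fun e => ?_
        rw [lintegral_lintegral_swap]
        exact (hK.comp ((measurable_fst.prodMk measurable_const).prodMk
          measurable_snd)).aemeasurable

lemma pos_of_norm_lt_norm_refl {e : Sp N} (he : ‖e‖ = 1) {s : ℝ} {y : Sp N}
    (hy : inner ℝ y e < s) (h : ‖y‖ < ‖refl e s y‖) : 0 < s := by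
  rw [← sq_lt_sq₀ (norm_nonneg _) (norm_nonneg _), norm_refl_sq he] at h
  by_contra hs
  nlinarith [mul_nonneg (neg_nonneg.2 (not_lt.1 hs)) (sub_pos.2 hy).le]

lemma exists_inter_ball_ne_zero {P : Set (Sp N)} (hP : volume P ≠ 0) :
    ∃ n : ℕ, ∀ m : ℕ, n ≤ m → volume (P ∩ Metric.ball 0 m) ≠ 0 := by
  by_contra hc
  push Not at hc
  refine hP (measure_mono_null ?_ (measure_iUnion_null fun n =>
    measure_mono_null (inter_subset_inter_right P (Metric.ball_subset_ball
      (Nat.cast_le.2 (hc n).choose_spec.1))) (hc n).choose_spec.2))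
  intro x hx
  obtain ⟨n, hn⟩ := exists_nat_gt ‖x‖
  exact mem_iUnion.2 ⟨n, hx, by simpa using hn⟩

lemma measure_sdiff_comm_of_eq {A B : Set (Sp N)} (hA : MeasurableSet A) (hB : MeasurableSet B)
    (hAB : volume A = volume B) (hfin : volume A ≠ ∞) : volume (A \ B) = volume (B \ A) := by
  have h1 := measure_inter_add_sdiff A hB (μ := volume)
  have h2 := measure_inter_add_sdiff B hA (μ := volume)
  rw [← hAB, inter_comm] at h2
  exact (ENNReal.add_right_inj ((measure_mono inter_subset_left).trans_lt hfin.lt_top).ne).1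
    (h1.trans h2.symm)

/-- A function which is not increased by the reflections moving points away from the origin agrees
with its rearrangement. -/
theorem ae_eq_rearrReal_of_ordered (hN : 1 ≤ N) {u : Sp N → ℝ} (hu : Measurable u)
    (hu0 : ∀ x, 0 ≤ u x) (hlev : ∀ τ : ℝ, 0 < τ → volume {x | τ < u x} < ∞)
    (h : ∀ e : Sp N, ‖e‖ = 1 → ∀ s : ℝ, 0 < s →
      ∀ᵐ x, inner ℝ x e < s → u (refl e s x) ≤ u x) :
    u =ᵐ[volume] rearrReal u := by
  refine ae_eq_of_level_ae_eq hu0 (rearrReal_nonneg u) fun t ht => ?_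
  refine Filter.EventuallyEq.trans ?_ (level_rearrReal_ae_eq hN hu hlev ht).symm
  set A := {x | t < u x}
  have hA : MeasurableSet A := measurableSet_lt measurable_const hu
  set B := setRearr A
  have hB : MeasurableSet B := measurableSet_setRearr A
  have hPQ : volume (A \ B) = volume (B \ A) := 
    measure_sdiff_comm_of_eq hA hB (volume_setRearr hN (hlev t ht).ne).symm (hlev t ht).ne
  suffices h0 : volume (A \ B) = 0 from
    ae_eq_set.2 ⟨h0, hPQ ▸ h0⟩
  -- `A` has points missing inside the ball `B` and, with equal volume, extra points outside it. By
  -- averaging, reflections would have to carry missing points onto extra points; such reflections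
  -- move points outward, and the order forbids this. Restricting to a large ball provides the
  -- distance bound required for averaging.
  by_contra hP
  obtain ⟨n1, hn1⟩ := exists_inter_ball_ne_zero hP
  obtain ⟨n2, hn2⟩ := exists_inter_ball_ne_zero (hPQ ▸ hP)
  set R : ℕ := max n1 n2
  set P := (A \ B) ∩ Metric.ball 0 (R : ℝ)
  set Q := (B \ A) ∩ Metric.ball 0 (R : ℝ)
  have hPm : MeasurableSet P := (hA.diff hB).inter Metric.isOpen_ball.measurableSet
  have hQm : MeasurableSet Q := (hB.diff hA).inter Metric.isOpen_ball.measurableSet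
  have hF : Measurable (Function.uncurry fun y x : Sp N =>
      Q.indicator (1 : Sp N → ℝ≥0∞) y * P.indicator (1 : Sp N → ℝ≥0∞) x) :=
    ((measurable_one.indicator hQm).comp measurable_fst).mul
      ((measurable_one.indicator hPm).comp measurable_snd)
  have hmem : ∀ y x : Sp N, Q.indicator (1 : Sp N → ℝ≥0∞) y * P.indicator (1 : Sp N → ℝ≥0∞) x ≠ 0 →
      y ∈ Q ∧ x ∈ P := by
    intro y x hne
    constructor
    · by_contra hc; exact hne (by rw [indicator_of_notMem hc, zero_mul])
    · by_contra hc; exact hne (by rw [indicator_of_notMem hc, mul_zero])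
  have havg := lintegral_lintegral_le_reflections hN hF (D := R + R) (fun y x hne => by
    obtain ⟨hy, hx⟩ := hmem y x hne
    have hx' : ‖x‖ < R := by simpa using hx.2
    have hy' : ‖y‖ < R := by simpa using hy.2
    linarith [norm_sub_le x y])
  have hl : ∫⁻ y, ∫⁻ x, Q.indicator (1 : Sp N → ℝ≥0∞) y * P.indicator (1 : Sp N → ℝ≥0∞) x =
      volume Q * volume P := by
    have : ∀ y, ∫⁻ x, Q.indicator (1 : Sp N → ℝ≥0∞) y * P.indicator (1 : Sp N → ℝ≥0∞) x =
        Q.indicator (1 : Sp N → ℝ≥0∞) y * volume P := fun y => by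
      rw [lintegral_const_mul _ (measurable_one.indicator hPm), lintegral_indicator_one hPm]
    simp only [this]
    rw [lintegral_mul_const _ (measurable_one.indicator hQm), lintegral_indicator_one hQm]
  have hz : ∀ e : Metric.sphere (0 : Sp N) 1, ∀ s : ℝ, ∫⁻ y,
      {y : Sp N | inner ℝ y (e : Sp N) < s}.indicator (fun y => Q.indicator (1 : Sp N → ℝ≥0∞) y *
        P.indicator (1 : Sp N → ℝ≥0∞) (refl (e : Sp N) s y)) y = 0 := by
    intro e s
    have he : ‖(e : Sp N)‖ = 1 := by simp
    have hae : ∀ᵐ y : Sp N, {y : Sp N | inner ℝ y (e : Sp N) < s}.indicator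
        (fun y => Q.indicator (1 : Sp N → ℝ≥0∞) y *
        P.indicator (1 : Sp N → ℝ≥0∞) (refl (e : Sp N) s y)) y = 0 := by
      have hord : ∀ᵐ y : Sp N, 0 < s → inner ℝ y (e : Sp N) < s →
          u (refl (e : Sp N) s y) ≤ u y := by
        by_cases hs : 0 < s
        · filter_upwards [h e he s hs] with y hy _ using hy
        · exact Filter.Eventually.of_forall fun y hs' => absurd hs' hs
      filter_upwards [hord] with y hy
      by_cases hys : inner ℝ y (e : Sp N) < s
      · rw [indicator_of_mem (show y ∈ {y : Sp N | inner ℝ y (e : Sp N) < s} from hys)]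
        by_contra hne
        obtain ⟨hyQ, hyP⟩ := hmem _ _ hne
        have h1 : ‖y‖ < rad A := mem_setRearr.1 hyQ.1.1
        have h2 : rad A ≤ ‖refl (e : Sp N) s y‖ :=
          not_lt.1 (fun hc => hyP.1.2 (mem_setRearr.2 hc))
        have hs := pos_of_norm_lt_norm_refl he hys (h1.trans_le h2)
        have h3 : t < u (refl (e : Sp N) s y) := hyP.1.1
        exact hyQ.1.2 (h3.trans_le (hy hs hys))
      · exact indicator_of_notMem (show y ∉ {y : Sp N | inner ℝ y (e : Sp N) < s} from hys) _
    rw [lintegral_congr_ae hae, lintegral_zero]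
  simp only [hz, lintegral_zero, mul_zero] at havg
  rw [hl] at havg
  have := mul_eq_zero.1 (le_antisymm havg zero_le)
  rcases this with h1 | h1
  · exact hn2 R (le_max_right _ _) h1
  · exact hn1 R (le_max_left _ _) h1

/-! ### Approximation of the rearrangement by polarizations -/

/-- Boundedness makes monotonicity valid at the origin too, where an infinite value of `rearr` would
be turned into `0` by `toReal`. -/
lemma rearrReal_le_of_norm_le_of_bdd (hN : 1 ≤ N) {u : Sp N → ℝ}
    (hlev : ∀ τ : ℝ, 0 < τ → volume {x | τ < u x} < ∞) {M : ℝ} (hM : 0 < M)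
    (hu : ∀ x, u x ≤ M) : (∀ x, rearrReal u x ≤ M) ∧
      ∀ x y : Sp N, ‖x‖ ≤ ‖y‖ → rearrReal u y ≤ rearrReal u x := by
  have h1 : ∀ x, rearr u x ≤ ENNReal.ofReal M := by
    intro x
    by_contra hc
    have := mem_setRearr.1 ((lt_rearr_iff hlev hM x).1 (not_le.1 hc))
    have hemp : {y | M < u y} = ∅ := eq_empty_iff_forall_notMem.2 fun y hy =>
      not_lt.2 (hu y) hy
    rw [hemp] at this
    rw [rad, measure_empty, ENNReal.toReal_zero, zero_div, Real.zero_rpow (by positivity)] at this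
    exact absurd this (not_lt.2 (norm_nonneg x))
  exact ⟨fun x => ENNReal.toReal_le_of_le_ofReal hM.le (h1 x), fun x y hxy =>
    ENNReal.toReal_mono ((h1 x).trans_lt ENNReal.ofReal_lt_top).ne
      (isSymmDecreasing_rearr u x y hxy)⟩

/-- If `a ≤ b`, matching `b` with `c` and `a` with `d` saves twice the overlap of `[a, b]` and `[d,
c]`. If `b ≤ a`, nothing is exchanged and the overlap term vanishes. -/
lemma abs_max_sub_add_abs_min_sub_le {a b c d : ℝ} (h : d ≤ c) :
    |max a b - c| + |min a b - d| + 2 * max 0 (min b c - max a d) ≤ |a - c| + |b - d| := by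
  rcases le_total a b with h1 | h1
  · rw [max_eq_right h1, min_eq_left h1]
    rcases le_total (min b c - max a d) 0 with h6 | h6
    on_goal 1 => rw [max_eq_left h6]
    on_goal 2 => rw [max_eq_right h6]
    all_goals
      rcases min_cases b c with ⟨h2, h2'⟩ | ⟨h2, h2'⟩ <;>
      rcases max_cases a d with ⟨h3, h3'⟩ | ⟨h3, h3'⟩ <;>
      rw [h2, h3] at h6 <;> (try rw [h2, h3]) <;>
      rcases abs_cases (b - c) with ⟨h7, _⟩ | ⟨h7, _⟩ <;>
      rcases abs_cases (a - d) with ⟨h8, _⟩ | ⟨h8, _⟩ <;>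
      rcases abs_cases (a - c) with ⟨h9, _⟩ | ⟨h9, _⟩ <;>
      rcases abs_cases (b - d) with ⟨h10, _⟩ | ⟨h10, _⟩ <;>
      rw [h7, h8, h9, h10] <;> linarith
  · rw [max_eq_left h1, min_eq_right h1, max_eq_left]
    · simp
    · have := min_le_left b c
      have := le_max_left a d
      linarith

/-- The amount by which the values of `f` at `x` and `y` are ordered differently from those
of `g`. -/
def ell (f g : Sp N → ℝ) (y x : Sp N) : ℝ≥0∞ :=
  ENNReal.ofReal (min (f x) (g y) - max (f y) (g x))

lemma measurable_ell {f g : Sp N → ℝ} (hf : Measurable f) (hg : Measurable g) :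
    Measurable (Function.uncurry (ell f g)) := by
  unfold ell Function.uncurry
  fun_prop

/-- The `L¹` distance. -/
def dist1 (f g : Sp N → ℝ) : ℝ≥0∞ := ∫⁻ x, ‖f x - g x‖ₑ

/-- The gain of polarization, integrated over the half-space. -/
def gain (f g : Sp N → ℝ) (e : Sp N) (s : ℝ) : ℝ≥0∞ :=
  ∫⁻ y, {y : Sp N | inner ℝ y e < s}.indicator (fun y => ell f g y (refl e s y)) y

/-- Apply the four-number inequality on each mirror pair and integrate. As `0 ≤ s`, the near point
carries the larger value of `g`. The gain lives on one half-space, so each pair counts it once. -/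
lemma dist1_pol_add_gain_le {f g : Sp N → ℝ} (hf : Measurable f) (hg : Measurable g)
    (hgs : ∀ x y : Sp N, ‖x‖ ≤ ‖y‖ → g y ≤ g x) {e : Sp N} (he : ‖e‖ = 1) {s : ℝ} (hs : 0 ≤ s) :
    dist1 (pol e s f) g + 2 * gain f g e s ≤ dist1 f g := by
  set G : Sp N → ℝ≥0∞ :=
    {y : Sp N | inner ℝ y e < s}.indicator (fun y => ell f g y (refl e s y))
  have hG : Measurable G := by
    refine Measurable.indicator ?_ (measurableSet_lt (by fun_prop) measurable_const)
    exact (measurable_ell hf hg).comp (measurable_id.prodMk (measurable_refl e s))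
  have hp := measurable_pol e s hf
  have m1 : Measurable fun x => ‖pol e s f x - g x‖ₑ := (hp.sub hg).enorm
  have m2 : Measurable fun x => ‖f x - g x‖ₑ := (hf.sub hg).enorm
  have key : ∀ x, (‖pol e s f x - g x‖ₑ + 2 * G x) +
      (‖pol e s f (refl e s x) - g (refl e s x)‖ₑ + 2 * G (refl e s x)) ≤
      ‖f x - g x‖ₑ + ‖f (refl e s x) - g (refl e s x)‖ₑ := by
    refine forall_of_half he s (fun x hx => ?_) (fun x h => ?_)
    · have h2 : G (refl e s x) = 0 := indicator_of_notMem (by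
        simp only [mem_ofPred_eq, inner_refl he]; linarith) _
      have h1 : G x ≤ ENNReal.ofReal (max 0 (min (f (refl e s x)) (g x) -
          max (f x) (g (refl e s x)))) := by
        refine (indicator_le_self' (fun _ _ => zero_le) x).trans ?_
        exact ENNReal.ofReal_le_ofReal (le_max_right _ _)
      have h3 := abs_max_sub_add_abs_min_sub_le (a := f x) (b := f (refl e s x))
        (hgs _ _ (norm_le_norm_refl he hs hx))
      rw [h2, pol_eq_max hx, pol_refl_eq_min he hx]
      simp only [Real.enorm_eq_ofReal_abs, mul_zero, add_zero]
      calc _ ≤ _ := add_le_add_left (add_le_add_right (mul_le_mul_right h1 2) _) _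
        _ = ENNReal.ofReal (|max (f x) (f (refl e s x)) - g x| +
            |min (f x) (f (refl e s x)) - g (refl e s x)| +
            2 * max 0 (min (f (refl e s x)) (g x) - max (f x) (g (refl e s x)))) := by
          rw [ENNReal.ofReal_add (by positivity) (by positivity),
            ENNReal.ofReal_add (by positivity) (by positivity), ENNReal.ofReal_mul (by norm_num)]
          simp only [ENNReal.ofReal_ofNat]
          ring
        _ ≤ _ := ENNReal.ofReal_le_ofReal h3
        _ = _ := ENNReal.ofReal_add (by positivity) (by positivity)
    · rw [refl_refl he] at h
      rw [add_comm, add_comm ‖f x - g x‖ₑ]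
      exact h
  have h1 := lintegral_add_refl he s (m1.add (hG.const_mul 2))
  have h2 := lintegral_add_refl he s m2
  have h3 := (h1.symm.le.trans (lintegral_mono key)).trans h2.le
  have h4 := (ENNReal.mul_le_mul_iff_right (by norm_num) (by norm_num)).1 h3
  simp only [Pi.add_apply] at h4
  rw [lintegral_add_left m1, lintegral_const_mul _ hG] at h4
  exact h4

/-- Functions with the bounds, the support and the distribution of `u`. -/
structure IsRearrOf (u : Sp N → ℝ) (M R : ℝ) (f : Sp N → ℝ) : Prop where
  meas : Measurable f
  nonneg : ∀ x, 0 ≤ f x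
  le : ∀ x, f x ≤ M
  supp : ∀ x, R ≤ ‖x‖ → f x = 0
  level : ∀ t : ℝ, 0 < t → volume {x | t < f x} = volume {x | t < u x}

/-- The condition `0 ≤ s` preserves the support: the reflection moves points of the half-space away
from the origin, so no nonzero value is brought outside the ball. -/
lemma IsRearrOf.pol {u f : Sp N → ℝ} {M R : ℝ} (h : IsRearrOf u M R f) {e : Sp N} (he : ‖e‖ = 1)
    {s : ℝ} (hs : 0 ≤ s) : IsRearrOf u M R (pol e s f) where
  meas := measurable_pol e s h.meas
  nonneg x := by
    unfold SymmRearr.pol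
    split_ifs
    · exact (h.nonneg x).trans (le_max_left _ _)
    · exact le_min (h.nonneg x) (h.nonneg _)
  le x := by
    unfold SymmRearr.pol
    split_ifs
    · exact max_le (h.le x) (h.le _)
    · exact (min_le_left _ _).trans (h.le x)
  supp x hx := by
    unfold SymmRearr.pol
    split_ifs with hlt
    · rw [h.supp x hx, h.supp _ (hx.trans (norm_le_norm_refl he hs hlt.le)), max_self]
    · rw [h.supp x hx, min_eq_left (h.nonneg _)]
  level t ht := by rw [volume_pol_level he s h.meas, h.level t ht]

lemma IsRearrOf.level_lt_top {u f : Sp N → ℝ} {M R : ℝ} (h : IsRearrOf u M R f) (τ : ℝ)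
    (hτ : 0 < τ) : volume {x | τ < f x} < ∞ := by
  refine (measure_mono (t := Metric.ball 0 R) fun x hx => ?_).trans_lt measure_ball_lt_top
  by_contra hc
  have h0 := h.supp x (by simpa using hc)
  have h1 : τ < f x := hx
  linarith

/-- The indicator function of the pairs `(t, y)` with `f y ≤ t < g y`. -/
def btw (f g : Sp N → ℝ) (t : ℝ) (y : Sp N) : ℝ≥0∞ := {y | f y ≤ t ∧ t < g y}.indicator 1 y

lemma measurable_btw {f g : Sp N → ℝ} (hf : Measurable f) (hg : Measurable g) :
    Measurable (Function.uncurry (btw f g)) := by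
  have h1 : MeasurableSet {p : ℝ × Sp N | f p.2 ≤ p.1} :=
    measurableSet_le (by fun_prop) (by fun_prop)
  have h2 : MeasurableSet {p : ℝ × Sp N | p.1 < g p.2} :=
    measurableSet_lt (by fun_prop) (by fun_prop)
  exact measurable_one.indicator (h1.inter h2)

lemma lintegral_btw {f g : Sp N → ℝ} (hf : Measurable f) (hg : Measurable g) (t : ℝ) :
    volume {y | f y ≤ t ∧ t < g y} = ∫⁻ y, btw f g t y :=
  (lintegral_indicator_one ((measurableSet_le hf measurable_const).inter
    (measurableSet_lt measurable_const hg))).symm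

/-- Tonelli: for fixed `x` and `y`, the admissible heights `t` form an interval of length `ell f g y
x`. -/
lemma lintegral_volume_mul_le {f g : Sp N → ℝ} (hf : Measurable f) (hg : Measurable g)
    (T : Set ℝ) :
    ∫⁻ t in T, volume {y | f y ≤ t ∧ t < g y} * volume {x | g x ≤ t ∧ t < f x} ≤
      ∫⁻ y, ∫⁻ x, ell f g y x := by
  have hq := measurable_btw hf hg
  have hp := measurable_btw hg hf
  set q := btw f g with hqd
  set p := btw g f with hpd
  have hqt : ∀ t, Measurable (q t) := fun t => hq.comp (measurable_const.prodMk measurable_id)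
  have hpt : ∀ t, Measurable (p t) := fun t => hp.comp (measurable_const.prodMk measurable_id)
  have e1 := lintegral_btw hf hg
  have e2 := lintegral_btw hg hf
  have e3 : ∀ y x, ∫⁻ t, q t y * p t x = ell f g y x := by
    intro y x
    have : ∀ t, q t y * p t x = (Ico (max (f y) (g x)) (min (f x) (g y))).indicator 1 t := by
      intro t
      simp only [hqd, hpd, btw, indicator_apply, mem_ofPred_eq, mem_Ico, max_le_iff, lt_min_iff,
        Pi.one_apply]
      by_cases h1 : f y ≤ t ∧ t < g y <;> by_cases h2 : g x ≤ t ∧ t < f x <;> (simp [h1, h2]; try tauto)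
    simp only [this]
    rw [lintegral_indicator_one measurableSet_Ico, Real.volume_Ico, ell]
  calc _ ≤ ∫⁻ t, volume {y | f y ≤ t ∧ t < g y} * volume {x | g x ≤ t ∧ t < f x} :=
        setLIntegral_le_lintegral _ _
    _ = ∫⁻ t, ∫⁻ y, ∫⁻ x, q t y * p t x := by
        refine lintegral_congr fun t => ?_
        rw [e1, e2, ← lintegral_mul_const _ (hqt t)]
        refine lintegral_congr fun y => ?_
        rw [lintegral_const_mul _ (hpt t)]
    _ = ∫⁻ y, ∫⁻ t, ∫⁻ x, q t y * p t x := by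
        refine lintegral_lintegral_swap (Measurable.aemeasurable ?_)
        refine Measurable.lintegral_prod_right' (f := fun a : (ℝ × Sp N) × Sp N =>
          q a.1.1 a.1.2 * p a.1.1 a.2) ?_
        exact (hq.comp measurable_fst).mul
          (hp.comp ((measurable_fst.comp measurable_fst).prodMk measurable_snd))
    _ = ∫⁻ y, ∫⁻ x, ∫⁻ t, q t y * p t x := by
        refine lintegral_congr fun y => ?_
        refine lintegral_lintegral_swap (Measurable.aemeasurable ?_)
        exact (hq.comp (measurable_fst.prodMk measurable_const)).mul hp
    _ = _ := by simp only [e3]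

lemma dist1_le_lintegral_volume {f g : Sp N → ℝ} (hf : Measurable f) (hg : Measurable g)
    (hf0 : ∀ x, 0 ≤ f x) (hg0 : ∀ x, 0 ≤ g x) {M : ℝ} (hfM : ∀ x, f x ≤ M) (hgM : ∀ x, g x ≤ M) :
    dist1 f g ≤ ∫⁻ t in Ioo 0 M, (volume {y | f y ≤ t ∧ t < g y} + volume {x | g x ≤ t ∧ t < f x}) := by
  have hq := measurable_btw hf hg
  have hp := measurable_btw hg hf
  set q := btw f g with hqd
  set p := btw g f with hpd
  have hqt : ∀ t, Measurable (q t) := fun t => hq.comp (measurable_const.prodMk measurable_id)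
  have e1 := lintegral_btw hf hg
  have e2 := lintegral_btw hg hf
  calc dist1 f g ≤ ∫⁻ y, ∫⁻ t in Ioo 0 M, (q t y + p t y) := by
        refine lintegral_mono fun y => ?_
        have h1 : ‖f y - g y‖ₑ = volume (Ioo (min (f y) (g y)) (max (f y) (g y))) := by
          rw [Real.volume_Ioo, max_sub_min_eq_abs', Real.enorm_eq_ofReal_abs]
        rw [h1, ← lintegral_indicator_one measurableSet_Ioo]
        have hsub : Ioo (min (f y) (g y)) (max (f y) (g y)) ⊆ Ioo 0 M := fun t ht =>
          ⟨(le_min (hf0 y) (hg0 y)).trans_lt ht.1, ht.2.trans_le (max_le (hfM y) (hgM y))⟩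
        rw [← inter_eq_right.2 hsub, ← indicator_indicator, lintegral_indicator measurableSet_Ioo]
        refine lintegral_mono fun t => ?_
        simp only [hqd, hpd, btw, indicator_apply, mem_ofPred_eq, mem_Ioo, min_lt_iff, lt_max_iff,
          Pi.one_apply]
        by_cases h1 : f y ≤ t ∧ t < g y
        · rw [if_pos h1]
          exact (by split_ifs <;> simp : _ ≤ (1 : ℝ≥0∞)).trans le_self_add
        by_cases h2 : g y ≤ t ∧ t < f y
        · rw [if_pos h2]
          exact (by split_ifs <;> simp : _ ≤ (1 : ℝ≥0∞)).trans le_add_self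
        rw [if_neg, if_neg h1, if_neg h2, add_zero]
        rintro ⟨h3, h4⟩
        rcases h3 with h3 | h3
        · exact absurd (h4.resolve_right fun h => h1 ⟨h3.le, h⟩) (not_lt.2 h3.le)
        · exact absurd (h4.resolve_left fun h => h2 ⟨h3.le, h⟩) (not_lt.2 h3.le)
    _ = ∫⁻ t in Ioo 0 M, ∫⁻ y, (q t y + p t y) := by
        refine lintegral_lintegral_swap (Measurable.aemeasurable ?_)
        exact (hq.comp measurable_swap).add (hp.comp measurable_swap)
    _ = _ := by
        refine lintegral_congr fun t => ?_
        rw [lintegral_add_left (hqt t), e1, e2]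

/-- `ell f g y x` vanishes unless `‖y‖ < ‖x‖ < R`. Hence only offsets in `(0, R]` contribute to the
average, and the uniform bound on the gain is integrated over a set of finite measure. -/
lemma lintegral_ell_le (hN : 1 ≤ N) {u f g : Sp N → ℝ} {M R : ℝ} (hf : IsRearrOf u M R f)
    (hg : Measurable g) (hgs : ∀ x y : Sp N, ‖x‖ ≤ ‖y‖ → g y ≤ g x) {η : ℝ≥0∞}
    (hη : ∀ e : Sp N, ‖e‖ = 1 → ∀ s, 0 < s → gain f g e s ≤ η) :
    ∫⁻ y, ∫⁻ x, ell f g y x ≤ ENNReal.ofReal ((R + R) ^ (N - 1)) * 2 *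
      ((volume : Measure (Sp N)).toSphere univ * ENNReal.ofReal R) * η := by
  have hell : ∀ y x, ell f g y x ≠ 0 → ‖x‖ < R ∧ ‖y‖ < ‖x‖ := by
    intro y x h
    have h1 : max (f y) (g x) < min (f x) (g y) := by
      by_contra hc
      exact h (ENNReal.ofReal_eq_zero.2 (by linarith))
    constructor
    · by_contra hc
      have h2 := hf.supp x (not_lt.1 hc)
      have := ((le_max_left _ _).trans_lt (h1.trans_le (min_le_left _ _)))
      linarith [hf.nonneg y]
    · by_contra hc
      have h2 := hgs x y (not_lt.1 hc)
      have := ((le_max_right _ _).trans_lt (h1.trans_le (min_le_right _ _)))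
      linarith
  refine (lintegral_lintegral_le_reflections hN (measurable_ell hf.meas hg) (D := R + R)
    (fun y x h => ?_)).trans ?_
  · obtain ⟨h1, h2⟩ := hell y x h
    linarith [norm_sub_le x y]
  rw [mul_assoc _ (_ * _) η]
  refine mul_le_mul_right ?_ _
  calc _ ≤ ∫⁻ _e : Metric.sphere (0 : Sp N) 1, ENNReal.ofReal R * η
        ∂(volume : Measure (Sp N)).toSphere := by
        refine lintegral_mono fun e => ?_
        have he : ‖(e : Sp N)‖ = 1 := by simp
        calc _ ≤ ∫⁻ s, (Ioc 0 R).indicator (fun _ => η) s := by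
              refine lintegral_mono fun s => ?_
              by_cases hs : s ∈ Ioc 0 R
              · rw [indicator_of_mem hs]
                exact hη e he s hs.1
              · rw [indicator_of_notMem hs]
                refine le_of_eq ((lintegral_congr fun y => ?_).trans lintegral_zero)
                by_cases hy : inner ℝ y (e : Sp N) < s
                · rw [indicator_of_mem (show y ∈ {y : Sp N | inner ℝ y (e : Sp N) < s} from hy)]
                  by_contra hne
                  obtain ⟨h1, h2⟩ := hell _ _ hne
                  refine hs ⟨pos_of_norm_lt_norm_refl he hy h2, ?_⟩
                  -- `2 * s` is the sum of the components of `y` and its mirror image along `e`,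
                  -- hence at most the sum of their norms.
                  have h3 := inner_refl he s y
                  have h4 := real_inner_le_norm y (e : Sp N)
                  have h5 := real_inner_le_norm (refl (e : Sp N) s y) (e : Sp N)
                  rw [he, mul_one] at h4 h5
                  linarith
                · exact indicator_of_notMem (show y ∉ {y : Sp N | inner ℝ y (e : Sp N) < s} from hy) _
          _ = ENNReal.ofReal R * η := by
              rw [lintegral_indicator_const measurableSet_Ioc, Real.volume_Ioc, sub_zero, mul_comm]
    _ = _ := by rw [lintegral_const]; ring

/-- Either `q ≤ ε` or `q ≤ q² / ε`. This replaces Cauchy–Schwarz in passing from `∫ q²` to `∫ q`. -/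
lemma le_add_inv_mul_mul {q ε : ℝ≥0∞} (h0 : ε ≠ 0) (hε : ε ≠ ∞) : q ≤ ε + ε⁻¹ * (q * q) := by
  rcases le_total q ε with h | h
  · exact h.trans le_self_add
  · refine le_trans ?_ le_add_self
    calc q = ε⁻¹ * (ε * q) := by rw [← mul_assoc, ENNReal.inv_mul_cancel h0 hε, one_mul]
      _ ≤ _ := by gcongr

/-- Equidistribution makes the two one-sided differences of level sets equally large, so their
product is a square `q²`. Its integral is at most a constant times `ε²` by averaging, and dividing
by `ε` leaves a bound linear in `ε`. -/
lemma dist1_le_of_gain_le (hN : 1 ≤ N) {u f : Sp N → ℝ} {M R : ℝ} (hu : IsRearrOf u M R u)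
    (hM : 0 < M) (hf : IsRearrOf u M R f) {ε : ℝ≥0∞} (h0 : ε ≠ 0) (hε : ε ≠ ∞)
    (hη : ∀ e : Sp N, ‖e‖ = 1 → ∀ s, 0 < s → gain f (rearrReal u) e s ≤ ε * ε) :
    dist1 f (rearrReal u) ≤ ε * (2 * (ENNReal.ofReal M + ENNReal.ofReal ((R + R) ^ (N - 1)) * 2 *
      ((volume : Measure (Sp N)).toSphere univ * ENNReal.ofReal R))) := by
  obtain ⟨hgM, hgs⟩ := rearrReal_le_of_norm_le_of_bdd hN hu.level_lt_top hM hu.le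
  have hg := measurable_rearrReal hN u
  have h1 := lintegral_ell_le hN hf hg hgs hη
  set C := ENNReal.ofReal ((R + R) ^ (N - 1)) * 2 *
      ((volume : Measure (Sp N)).toSphere univ * ENNReal.ofReal R)
  set g := rearrReal u
  have h2 := (lintegral_volume_mul_le hf.meas hg (Ioo 0 M)).trans h1
  have h3 : ∀ t ∈ Ioo 0 M, volume {x | g x ≤ t ∧ t < f x} = volume {y | f y ≤ t ∧ t < g y} := by
    intro t ht
    have hA : MeasurableSet {x | t < f x} := measurableSet_lt measurable_const hf.meas
    have hB : MeasurableSet {x | t < g x} := measurableSet_lt measurable_const hg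
    have := measure_sdiff_comm_of_eq hA hB ((hf.level t ht.1).trans
      (volume_level_rearrReal hN hu.meas hu.level_lt_top ht.1).symm) (hf.level_lt_top t ht.1).ne
    have e1 : ∀ a b : Sp N → ℝ, {x | a x ≤ t ∧ t < b x} = {x | t < b x} \ {x | t < a x} := by
      intro a b
      ext x
      simp only [mem_sdiff, mem_ofPred_eq, not_lt]
      exact and_comm
    rw [e1, e1, this]
  set q : ℝ → ℝ≥0∞ := fun t => volume {y | f y ≤ t ∧ t < g y}
  calc dist1 f g ≤ ∫⁻ t in Ioo 0 M, (volume {y | f y ≤ t ∧ t < g y} +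
          volume {x | g x ≤ t ∧ t < f x}) :=
        dist1_le_lintegral_volume hf.meas hg hf.nonneg (rearrReal_nonneg u) hf.le hgM
    _ ≤ ∫⁻ t in Ioo 0 M, 2 * (ε + ε⁻¹ * (volume {y | f y ≤ t ∧ t < g y} *
          volume {x | g x ≤ t ∧ t < f x})) := by
        refine setLIntegral_mono' measurableSet_Ioo fun t ht => ?_
        rw [h3 t ht, ← two_mul]
        exact mul_le_mul_right (le_add_inv_mul_mul h0 hε) 2
    _ = 2 * (ε * ENNReal.ofReal M + ε⁻¹ * ∫⁻ t in Ioo 0 M, volume {y | f y ≤ t ∧ t < g y} *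
          volume {x | g x ≤ t ∧ t < f x}) := by
        rw [lintegral_const_mul' _ _ (by norm_num), lintegral_add_left measurable_const,
          lintegral_const_mul' _ _ (ENNReal.inv_ne_top.2 h0), setLIntegral_const, Real.volume_Ioo,
          sub_zero]
    _ ≤ 2 * (ε * ENNReal.ofReal M + ε⁻¹ * (C * (ε * ε))) := by gcongr
    _ = 2 * (ε * ENNReal.ofReal M + (ε⁻¹ * ε) * (C * ε)) := by ring
    _ = ε * (2 * (ENNReal.ofReal M + C)) := by
        rw [ENNReal.inv_mul_cancel h0 hε]; ring

lemma dist1_rearrReal_lt_top (hN : 1 ≤ N) {u : Sp N → ℝ} {M R : ℝ} (hu : IsRearrOf u M R u)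
    (hM : 0 < M) : dist1 u (rearrReal u) < ∞ := by
  obtain ⟨hgM, -⟩ := rearrReal_le_of_norm_le_of_bdd hN hu.level_lt_top hM hu.le
  have hV : ∀ t : ℝ, 0 < t → volume {x | t < u x} ≤ volume (Metric.ball (0 : Sp N) R) := by
    intro t ht
    refine measure_mono fun x hx => ?_
    by_contra hc
    have h0 := hu.supp x (by simpa using hc)
    have h1 : t < u x := hx
    linarith
  calc dist1 u (rearrReal u) ≤ _ := dist1_le_lintegral_volume hu.meas (measurable_rearrReal hN u)
        hu.nonneg (rearrReal_nonneg u) hu.le hgM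
    _ ≤ ∫⁻ _t in Ioo 0 M, (volume (Metric.ball (0 : Sp N) R) + volume (Metric.ball (0 : Sp N) R)) := by
        refine setLIntegral_mono' measurableSet_Ioo fun t ht => add_le_add ?_ ?_
        · refine le_trans ?_ (hV t ht.1)
          rw [← volume_level_rearrReal hN hu.meas hu.level_lt_top ht.1]
          exact measure_mono fun x hx => hx.2
        · exact (measure_mono fun x hx => hx.2).trans (hV t ht.1)
    _ < ∞ := by
        rw [setLIntegral_const, Real.volume_Ioo]
        exact ENNReal.mul_lt_top (ENNReal.add_lt_top.2 ⟨measure_ball_lt_top, measure_ball_lt_top⟩)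
          ENNReal.ofReal_lt_top

/-- A class of functions which is stable under polarization contains functions close to the
rearrangement. -/
theorem exists_dist1_lt (hN : 1 ≤ N) {u : Sp N → ℝ} {M R : ℝ} (hu : IsRearrOf u M R u)
    (hM : 0 < M) {p : (Sp N → ℝ) → Prop} (hpu : p u)
    (hp : ∀ f, IsRearrOf u M R f → p f → ∀ e : Sp N, ‖e‖ = 1 → ∀ s, p (pol e s f))
    {δ : ℝ≥0∞} (hδ : δ ≠ 0) :
    ∃ f, IsRearrOf u M R f ∧ p f ∧ dist1 f (rearrReal u) < δ := by
  obtain ⟨hgM, hgs⟩ := rearrReal_le_of_norm_le_of_bdd hN hu.level_lt_top hM hu.le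
  have hg := measurable_rearrReal hN u
  set S : Set ℝ≥0∞ := {d | ∃ f, IsRearrOf u M R f ∧ p f ∧ dist1 f (rearrReal u) = d}
  have hS : S.Nonempty := ⟨_, u, hu, hpu, rfl⟩
  set K : ℝ≥0∞ := 2 * (ENNReal.ofReal M + ENNReal.ofReal ((R + R) ^ (N - 1)) * 2 *
      ((volume : Measure (Sp N)).toSphere univ * ENNReal.ofReal R))
  have hK : K ≠ ∞ := by
    refine ENNReal.mul_ne_top (by norm_num) (ENNReal.add_ne_top.2 ⟨ENNReal.ofReal_ne_top, ?_⟩)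
    exact ENNReal.mul_ne_top (ENNReal.mul_ne_top ENNReal.ofReal_ne_top (by norm_num))
      (ENNReal.mul_ne_top (measure_ne_top _ _) ENNReal.ofReal_ne_top)
  have hmem : ∀ f, IsRearrOf u M R f → p f → sInf S ≤ dist1 f (rearrReal u) :=
    fun f hf hpf => csInf_le (OrderBot.bddBelow S) ⟨f, hf, hpf, rfl⟩
  have htop : sInf S ≠ ∞ := ((hmem u hu hpu).trans_lt (dist1_rearrReal_lt_top hN hu hM)).ne
  have hle : ∀ ε : ℝ≥0∞, ε ≠ 0 → ε ≠ ∞ → sInf S ≤ ε * K := by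
    intro ε h0 hε
    -- Choose `f` within `ε * ε` of the infimum. Its polarizations stay in the class and cannot go
    -- below the infimum, so every gain is at most `ε * ε`.
    obtain ⟨d, ⟨f, hf, hpf, rfl⟩, hd⟩ := exists_lt_of_csInf_lt hS
      (ENNReal.lt_add_right htop (mul_ne_zero h0 h0))
    refine (hmem f hf hpf).trans (dist1_le_of_gain_le hN hu hM hf h0 hε ?_)
    intro e he s hs
    have h1 : sInf S ≤ dist1 (pol e s f) (rearrReal u) :=
      hmem _ (hf.pol he hs.le) (hp f hf hpf e he s)
    have h2 := dist1_pol_add_gain_le hf.meas hg hgs he hs.le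
    have h3 := ((add_le_add_left h1 _).trans h2).trans hd.le
    have h4 := (ENNReal.add_le_add_iff_left htop).1 h3
    exact (le_mul_of_one_le_left zero_le one_le_two).trans h4
  have hzero : sInf S = 0 := by
    have hlim : Filter.Tendsto (fun n : ℕ => ((n : ℝ≥0∞) + 1)⁻¹ * K) Filter.atTop (nhds 0) := by
      have := ENNReal.Tendsto.mul_const (b := K)
        ((Filter.tendsto_add_atTop_iff_nat 1).2 ENNReal.tendsto_inv_nat_nhds_zero) (Or.inr hK)
      simpa using this
    refine le_antisymm (ge_of_tendsto' hlim fun n => hle _ ?_ ?_) zero_le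
    · exact ENNReal.inv_ne_zero.2 (by finiteness)
    · exact ENNReal.inv_ne_top.2 (by positivity)
  obtain ⟨d, ⟨f, hf, hpf, rfl⟩, hd⟩ := exists_lt_of_csInf_lt hS
    (hzero.trans_lt (pos_iff_ne_zero.2 hδ))
  exact ⟨f, hf, hpf, hd⟩

/-! ### The energy does not increase under rearrangement -/

lemma energy_congr_ae {J : ℝ → ℝ} {k : Sp N → ℝ≥0∞} {f g : Sp N → ℝ} (h : f =ᵐ[volume] g) :
    energy J k f = energy J k g := by
  refine lintegral_congr_ae ?_
  filter_upwards [h] with x hx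
  refine lintegral_congr_ae ?_
  filter_upwards [h] with y hy
  rw [hx, hy]

lemma energy_le_liminf {J : ℝ → ℝ} (hJ : Continuous J) {k : Sp N → ℝ≥0∞} (hk : Measurable k)
    {f : Sp N → ℝ} {w : ℕ → Sp N → ℝ} (hf : Measurable f) (hw : ∀ n, Measurable (w n))
    (h : ∀ᵐ x, Filter.Tendsto (fun n => w n x) Filter.atTop (nhds (f x))) :
    energy J k f ≤ Filter.liminf (fun n => energy J k (w n)) Filter.atTop := by
  simp only [energy_eq_lintegral_dens hJ.measurable hk hf,
    energy_eq_lintegral_dens hJ.measurable hk (hw _)]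
  refine le_trans (lintegral_mono_ae ?_)
    (lintegral_liminf_le fun n => measurable_dens hJ.measurable hk (hw n))
  filter_upwards [Measure.quasiMeasurePreserving_fst.ae h,
    Measure.quasiMeasurePreserving_snd.ae h] with z h1 h2
  have h3 : Filter.Tendsto (fun n => ENNReal.ofReal (J (w n z.1 - w n z.2))) Filter.atTop
      (nhds (ENNReal.ofReal (J (f z.1 - f z.2)))) :=
    ENNReal.tendsto_ofReal ((hJ.tendsto _).comp (h1.sub h2))
  -- The kernel may be infinite, and multiplication by `∞` is discontinuous at `0`; there the bound
  -- is trivial.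
  by_cases h0 : ENNReal.ofReal (J (f z.1 - f z.2)) = 0
  · rw [dens, h0, zero_mul]; exact zero_le
  · exact (ENNReal.Tendsto.mul_const h3 (Or.inl h0)).liminf_eq.ge

lemma energy_le_of_forall_le {J : ℝ → ℝ} (hJ : Continuous J) {k : Sp N → ℝ≥0∞} (hk : Measurable k)
    {f : Sp N → ℝ} {w : ℕ → Sp N → ℝ} (hf : Measurable f) (hw : ∀ n, Measurable (w n))
    (h : ∀ᵐ x, Filter.Tendsto (fun n => w n x) Filter.atTop (nhds (f x))) {E : ℝ≥0∞}
    (hE : ∀ n, energy J k (w n) ≤ E) : energy J k f ≤ E := by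
  refine (energy_le_liminf hJ hk hf hw h).trans ?_
  calc _ ≤ Filter.liminf (fun _ : ℕ => E) Filter.atTop :=
        Filter.liminf_le_liminf (Filter.Eventually.of_forall hE)
    _ = E := Filter.liminf_const E

/-- The functions with energy at most that of `u` form a class stable under polarization. Members
converging in L¹ to the rearrangement have an almost everywhere convergent subsequence, and Fatou's
lemma concludes. -/
lemma energy_rearrReal_le_of_bdd_supp (hN : 1 ≤ N) {J : ℝ → ℝ} (hJ : ConvexOn ℝ univ J)
    (hJ0 : ∀ t, 0 ≤ J t) {k : Sp N → ℝ≥0∞} (hk : IsSymmDecreasing k) {u : Sp N → ℝ} {M R : ℝ}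
    (hM : 0 < M) (hu : IsRearrOf u M R u) : energy J k (rearrReal u) ≤ energy J k u := by
  have hkm := hk.measurable hN
  have hg := measurable_rearrReal hN u
  have hex : ∀ n : ℕ, ∃ f, IsRearrOf u M R f ∧ energy J k f ≤ energy J k u ∧
      dist1 f (rearrReal u) < ((n : ℝ≥0∞))⁻¹ := fun n =>
    exists_dist1_lt hN hu hM (p := fun f => energy J k f ≤ energy J k u) le_rfl
      (fun f hf hpf e he s => (energy_pol_le hJ hJ0 hk hkm he s hf.meas).trans hpf)
      (ENNReal.inv_ne_zero.2 (ENNReal.natCast_ne_top n))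
  choose f hf hfE hfd using hex
  have hlim : Filter.Tendsto (fun n => eLpNorm (f n - rearrReal u) 1 volume) Filter.atTop
      (nhds 0) := by
    refine tendsto_of_tendsto_of_tendsto_of_le_of_le tendsto_const_nhds
      ENNReal.tendsto_inv_nat_nhds_zero (fun _ => zero_le) (fun n => ?_)
    simp only [eLpNorm_one_eq_lintegral_enorm]
    exact (hfd n).le
  obtain ⟨ns, -, hns⟩ := (tendstoInMeasure_of_tendsto_eLpNorm one_ne_zero
    (fun n => (hf n).meas.aestronglyMeasurable) hg.aestronglyMeasurable
    hlim).exists_seq_tendsto_ae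
  exact energy_le_of_forall_le (continuous_of_convexOn_univ hJ) hkm hg (fun n => (hf (ns n)).meas)
    hns fun n => hfE _

/-! ### Removing the assumptions of bounded support and boundedness -/

lemma le_of_between_zero {J : ℝ → ℝ} (hJ : ConvexOn ℝ univ J) (hJ0 : ∀ t, 0 ≤ J t)
    (hz : J 0 = 0) {c d : ℝ} (h : (0 ≤ c ∧ c ≤ d) ∨ (d ≤ c ∧ c ≤ 0)) : J c ≤ J d := by
  rcases h with h | h
  · have := hJ.le_max_of_mem_Icc (mem_univ 0) (mem_univ d) (z := c) h
    rwa [hz, max_eq_right (hJ0 d)] at this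
  · have := hJ.le_max_of_mem_Icc (mem_univ d) (mem_univ 0) (z := c) h
    rwa [hz, max_eq_left (hJ0 d)] at this

lemma lintegral_indicator_mul_kernel {k : Sp N → ℝ≥0∞} (hk : Measurable k) {S : Set (Sp N)}
    (hS : MeasurableSet S) :
    ∫⁻ z : Sp N × Sp N, (S.indicator 1 z.1 + S.indicator 1 z.2) * k (z.1 - z.2)
      ∂(volume.prod volume) = 2 * (volume S * ∫⁻ x, k x) := by
  have hi : Measurable (S.indicator (1 : Sp N → ℝ≥0∞)) := measurable_one.indicator hS
  have m1 : Measurable fun z : Sp N × Sp N => S.indicator (1 : Sp N → ℝ≥0∞) z.1 * k (z.1 - z.2) := by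
    fun_prop
  have m2 : Measurable fun z : Sp N × Sp N => S.indicator (1 : Sp N → ℝ≥0∞) z.2 * k (z.1 - z.2) := by
    fun_prop
  have hk1 : ∀ x : Sp N, Measurable fun y => k (x - y) := fun x => by fun_prop
  have hk2 : ∀ y : Sp N, Measurable fun x => k (x - y) := fun x => by fun_prop
  simp only [add_mul]
  rw [lintegral_add_left m1, lintegral_prod _ m1.aemeasurable, lintegral_prod_symm _ m2.aemeasurable]
  simp only [lintegral_const_mul _ (hk1 _), lintegral_const_mul _ (hk2 _),
    lintegral_sub_left_eq_self k, lintegral_sub_right_eq_self k]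
  rw [lintegral_mul_const _ hi, lintegral_indicator_one hS, two_mul]

/-- Cutting `u` off outside a ball may increase some differences, so the energies of the cut-offs
are handled by dominated convergence. The majorant is a constant times the kernel on pairs meeting
the support, integrable because `k` is integrable and the support has finite measure. -/
lemma energy_rearrReal_le_of_bdd (hN : 1 ≤ N) {J : ℝ → ℝ} (hJ : ConvexOn ℝ univ J)
    (hJ0 : ∀ t, 0 ≤ J t) (hz : J 0 = 0) {k : Sp N → ℝ≥0∞} (hk : IsSymmDecreasing k)
    (hki : ∫⁻ x, k x ≠ ∞) {u : Sp N → ℝ} (hu : Measurable u) (hu0 : ∀ x, 0 ≤ u x) {M : ℝ}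
    (hM : 0 < M) (huM : ∀ x, u x ≤ M) (hfin : volume {x | 0 < u x} < ∞) :
    energy J k (rearrReal u) ≤ energy J k u := by
  have hkm := hk.measurable hN
  have hJc := continuous_of_convexOn_univ hJ
  have hlev : ∀ τ : ℝ, 0 < τ → volume {x | τ < u x} < ∞ := fun τ hτ =>
    (measure_mono fun x (hx : τ < u x) => hτ.trans hx).trans_lt hfin
  let w : ℕ → Sp N → ℝ := fun n => (Metric.ball 0 (n : ℝ)).indicator u
  have hw : ∀ n, Measurable (w n) := fun n => hu.indicator Metric.isOpen_ball.measurableSet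
  have hw0 : ∀ n x, 0 ≤ w n x := fun n x => indicator_nonneg (fun _ _ => hu0 _) x
  have hwu : ∀ n x, w n x ≤ u x := fun n x => indicator_le_self' (fun _ _ => hu0 _) x
  have hev : ∀ x, ∀ᶠ n : ℕ in Filter.atTop, w n x = u x := by
    intro x
    obtain ⟨m, hm⟩ := exists_nat_gt ‖x‖
    filter_upwards [Filter.eventually_ge_atTop m] with n hn
    refine indicator_of_mem ?_ _
    have : (m : ℝ) ≤ n := by exact_mod_cast hn
    simpa using hm.trans_le this
  have hR : ∀ n, IsRearrOf (w n) M n (w n) := fun n =>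
    { meas := hw n
      nonneg := hw0 n
      le := fun x => (hwu n x).trans (huM x)
      supp := fun x hx => indicator_of_notMem (by simpa using hx) _
      level := fun t _ => rfl }
  have hE : ∀ n, energy J k (rearrReal (w n)) ≤ energy J k (w n) := fun n =>
    energy_rearrReal_le_of_bdd_supp hN hJ hJ0 hk hM (hR n)
  have hmono : Monotone w := by
    intro a b hab x
    refine indicator_le_indicator_of_subset (Metric.ball_subset_ball ?_) (fun x => hu0 x) x
    exact_mod_cast hab
  have hr : ∀ᵐ x, Filter.Tendsto (fun n => rearrReal (w n) x) Filter.atTop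
      (nhds (rearrReal u x)) := by
    filter_upwards [ae_ne_zero hN] with x hx
    exact rearrReal_tendsto_of_monotone hN hu hw hlev hmono
      (fun y => tendsto_nhds_of_eventually_eq (hev y)) hx
  set C : ℝ≥0∞ := ENNReal.ofReal (max (J M) (J (-M)))
  have hlim : Filter.Tendsto (fun n => energy J k (w n)) Filter.atTop (nhds (energy J k u)) := by
    simp only [energy_eq_lintegral_dens hJc.measurable hkm hu,
      energy_eq_lintegral_dens hJc.measurable hkm (hw _)]
    have hS : MeasurableSet {x | 0 < u x} := measurableSet_lt measurable_const hu
    have hi := lintegral_indicator_mul_kernel hkm hS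
    refine tendsto_lintegral_of_dominated_convergence
      (fun z => C * (({x | 0 < u x}.indicator 1 z.1 + {x | 0 < u x}.indicator 1 z.2) * k (z.1 - z.2)))
      (fun n => measurable_dens hJc.measurable hkm (hw n)) (fun n => ?_) ?_ ?_
    · refine Filter.Eventually.of_forall fun z => ?_
      change ENNReal.ofReal (J (w n z.1 - w n z.2)) * k (z.1 - z.2) ≤
        C * (({x | 0 < u x}.indicator 1 z.1 + {x | 0 < u x}.indicator 1 z.2) * k (z.1 - z.2))
      rw [← mul_assoc]
      refine mul_le_mul_left ?_ _
      have hb : ENNReal.ofReal (J (w n z.1 - w n z.2)) ≤ C := by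
        refine ENNReal.ofReal_le_ofReal ?_
        have := hJ.le_max_of_mem_Icc (mem_univ (-M)) (mem_univ M) (z := w n z.1 - w n z.2)
          ⟨by linarith [hw0 n z.1, (hwu n z.2).trans (huM _)],
            by linarith [hw0 n z.2, (hwu n z.1).trans (huM _)]⟩
        rwa [max_comm]
      by_cases h1 : 0 < u z.1
      · rw [indicator_of_mem (show z.1 ∈ {x | 0 < u x} from h1)]
        exact hb.trans (le_mul_of_one_le_right zero_le le_self_add)
      by_cases h2 : 0 < u z.2
      · rw [indicator_of_mem (show z.2 ∈ {x | 0 < u x} from h2)]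
        exact hb.trans (le_mul_of_one_le_right zero_le le_add_self)
      have e1 : w n z.1 = 0 := le_antisymm ((hwu n _).trans (not_lt.1 h1)) (hw0 n _)
      have e2 : w n z.2 = 0 := le_antisymm ((hwu n _).trans (not_lt.1 h2)) (hw0 n _)
      rw [e1, e2, sub_zero, hz, ENNReal.ofReal_zero]
      exact zero_le
    · rw [lintegral_const_mul' _ _ ENNReal.ofReal_ne_top, hi]
      exact ENNReal.mul_ne_top ENNReal.ofReal_ne_top
        (ENNReal.mul_ne_top (by norm_num) (ENNReal.mul_ne_top hfin.ne hki))
    · refine Filter.Eventually.of_forall fun z => tendsto_nhds_of_eventually_eq ?_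
      filter_upwards [hev z.1, hev z.2] with n h1 h2
      simp only [dens, h1, h2]
  calc energy J k (rearrReal u) ≤ Filter.liminf (fun n => energy J k (rearrReal (w n))) Filter.atTop :=
        energy_le_liminf hJc hkm (measurable_rearrReal hN u) (fun n => measurable_rearrReal hN _) hr
    _ ≤ Filter.liminf (fun n => energy J k (w n)) Filter.atTop :=
        Filter.liminf_le_liminf (Filter.Eventually.of_forall hE)
    _ = energy J k u := hlim.liminf_eq

/-- Truncation of a nonnegative number from below and above. -/
def trunc (n : ℕ) (a : ℝ) : ℝ := min (max (a - 1 / ((n : ℝ) + 1)) 0) n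

lemma trunc_nonneg (n : ℕ) (a : ℝ) : 0 ≤ trunc n a :=
  le_min (le_max_right _ _) (Nat.cast_nonneg n)

/-- Truncation is nondecreasing and 1-Lipschitz. As `J` grows away from its minimum at `0`,
truncating `u` lowers the energy density pointwise. -/
lemma trunc_sub_le {n : ℕ} {a b : ℝ} (h : b ≤ a) :
    0 ≤ trunc n a - trunc n b ∧ trunc n a - trunc n b ≤ a - b := by
  unfold trunc
  set ε := 1 / ((n : ℝ) + 1)
  set m := (n : ℝ)
  rcases max_cases (a - ε) 0 with ⟨h1, h2⟩ | ⟨h1, h2⟩ <;>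
  rcases max_cases (b - ε) 0 with ⟨h3, h4⟩ | ⟨h3, h4⟩ <;> rw [h1, h3] <;>
  constructor <;>
  first
  | (rcases min_cases (a - ε) m with ⟨h5, h6⟩ | ⟨h5, h6⟩ <;>
      rcases min_cases (b - ε) m with ⟨h7, h8⟩ | ⟨h7, h8⟩ <;> linarith)
  | (rcases min_cases (a - ε) m with ⟨h5, h6⟩ | ⟨h5, h6⟩ <;>
      rcases min_cases 0 m with ⟨h7, h8⟩ | ⟨h7, h8⟩ <;> linarith)

lemma trunc_mono_left {a b : ℕ} (hab : a ≤ b) (x : ℝ) : trunc a x ≤ trunc b x := by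
  unfold trunc
  have h1 := one_div_le_one_div_of_le (by positivity : (0 : ℝ) < (a : ℝ) + 1)
      (by exact_mod_cast Nat.succ_le_succ hab : (a : ℝ) + 1 ≤ (b : ℝ) + 1)
  exact min_le_min (max_le_max_right _ (by linarith)) (by exact_mod_cast hab)

lemma tendsto_trunc {a : ℝ} (ha : 0 ≤ a) :
    Filter.Tendsto (fun n => trunc n a) Filter.atTop (nhds a) := by
  have h1 : Filter.Tendsto (fun n : ℕ => max (a - 1 / ((n : ℝ) + 1)) 0) Filter.atTop (nhds a) := by
    have h := ((tendsto_const_nhds (x := a)).sub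
      (tendsto_one_div_add_atTop_nhds_zero_nat (𝕜 := ℝ))).max (tendsto_const_nhds (x := (0 : ℝ)))
    rwa [sub_zero, max_eq_left ha] at h
  refine h1.congr' ?_
  obtain ⟨m, hm⟩ := exists_nat_ge a
  filter_upwards [Filter.eventually_ge_atTop m] with n hn
  have hn' : (m : ℝ) ≤ n := by exact_mod_cast hn
  have h2 : (0 : ℝ) < 1 / ((n : ℝ) + 1) := by positivity
  exact (min_eq_left (max_le (by linarith) (Nat.cast_nonneg n))).symm

/-- The energy does not increase under symmetric decreasing rearrangement. -/
theorem energy_rearrReal_le (hN : 1 ≤ N) {J : ℝ → ℝ} (hJ : ConvexOn ℝ univ J)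
    (hJ0 : ∀ t, 0 ≤ J t) (hz : J 0 = 0) {k : Sp N → ℝ≥0∞} (hk : IsSymmDecreasing k)
    (hki : ∫⁻ x, k x ≠ ∞) {u : Sp N → ℝ} (hu : Measurable u) (hu0 : ∀ x, 0 ≤ u x)
    (hlev : ∀ τ : ℝ, 0 < τ → volume {x | τ < u x} < ∞) :
    energy J k (rearrReal u) ≤ energy J k u := by
  have hkm := hk.measurable hN
  let w : ℕ → Sp N → ℝ := fun n x => trunc n (u x)
  have hw : ∀ n, Measurable (w n) := fun n => by
    simp only [w, trunc]; fun_prop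
  have hE : ∀ n, energy J k (w n) ≤ energy J k u := fun n => by
    refine lintegral_mono fun x => lintegral_mono fun y => mul_le_mul_left ?_ _
    refine ENNReal.ofReal_le_ofReal (le_of_between_zero hJ hJ0 hz ?_)
    rcases le_total (u y) (u x) with h | h
    · exact Or.inl (trunc_sub_le h)
    · have := trunc_sub_le (n := n) h
      exact Or.inr ⟨by simp only [w]; linarith, by simp only [w]; linarith⟩
  have hE2 : ∀ n, energy J k (rearrReal (w n)) ≤ energy J k u := fun n => by
    have hpos : (0 : ℝ) < 1 / ((n : ℝ) + 1) := by positivity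
    -- The bound `n + 1` is used instead of `n` because it must be positive also for `n = 0`. The
    -- support of the truncation lies in `{u > 1 / (n + 1)}`, which has finite measure.
    refine (energy_rearrReal_le_of_bdd hN hJ hJ0 hz hk hki (hw n) (fun x => trunc_nonneg _ _)
      (M := n + 1) (by positivity) (fun x => (min_le_right _ _).trans (by linarith))
      ((measure_mono ?_).trans_lt (hlev _ hpos))).trans (hE n)
    intro x hx
    have h1 : 0 < max (u x - 1 / ((n : ℝ) + 1)) 0 := lt_of_lt_of_le hx (min_le_left _ _)
    rcases lt_max_iff.1 h1 with h2 | h2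
    · exact sub_pos.1 h2
    · exact absurd h2 (lt_irrefl _)
  refine energy_le_of_forall_le (continuous_of_convexOn_univ hJ) hkm (measurable_rearrReal hN u)
    (fun n => measurable_rearrReal hN (w n)) ?_ hE2
  filter_upwards [ae_ne_zero hN] with x hx
  exact rearrReal_tendsto_of_monotone hN hu hw hlev (fun a b hab y => trunc_mono_left hab _)
    (fun y => tendsto_trunc (hu0 y)) hx

/-! ### Functions ordered with respect to all reflections -/

/-- A function with level sets of finite measure is ordered like an integrable function. -/
lemma exists_integrable_weight {u : Sp N → ℝ} (hu : Measurable u) (hu0 : ∀ x, 0 ≤ u x)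
    (hlev : ∀ τ : ℝ, 0 < τ → volume {x | τ < u x} < ∞) :
    ∃ v : Sp N → ℝ≥0∞, Measurable v ∧ ∫⁻ x, v x ≠ ∞ ∧ ∀ x y, v x ≤ v y ↔ u x ≤ u y := by
  obtain ⟨c, hc, hsum⟩ := ENNReal.exists_pos_sum_of_countable' one_ne_zero {q : ℚ // 0 < q}
  let A : {q : ℚ // 0 < q} → Set (Sp N) := fun q => {x | ((q : ℚ) : ℝ) < u x}
  have hA : ∀ q, MeasurableSet (A q) := fun q => measurableSet_lt measurable_const hu
  have hAfin : ∀ q, volume (A q) < ∞ := fun q => hlev _ (by exact_mod_cast q.2)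
  -- With these weights both `∑ d q` and `∑ d q * |A q|` are finite: `v` is finite everywhere, which
  -- strict comparison of series needs, and integrable. Density of the rationals makes `v` strictly
  -- increasing in `u`.
  let d : {q : ℚ // 0 < q} → ℝ≥0∞ := fun q => c q * (1 + volume (A q))⁻¹
  have hd0 : ∀ q, d q ≠ 0 := fun q => mul_ne_zero (hc q).ne'
    (ENNReal.inv_ne_zero.2 (ENNReal.add_ne_top.2 ⟨ENNReal.one_ne_top, (hAfin q).ne⟩))
  have hone : ∀ q, (1 + volume (A q))⁻¹ ≤ 1 := fun q => ENNReal.inv_le_one.2 le_self_add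
  have hdc : ∀ q, d q ≤ c q := fun q => mul_le_of_le_one_right zero_le (hone q)
  have hdA : ∀ q, d q * volume (A q) ≤ c q := fun q => by
    rw [mul_assoc]
    refine mul_le_of_le_one_right zero_le ?_
    rw [mul_comm, ← div_eq_mul_inv]
    exact ENNReal.div_le_of_le_mul (by rw [one_mul]; exact le_add_self)
  let v : Sp N → ℝ≥0∞ := fun x => ∑' q, d q * (A q).indicator 1 x
  have hterm : ∀ q, Measurable fun x => d q * (A q).indicator (1 : Sp N → ℝ≥0∞) x := fun q =>
    (measurable_one.indicator (hA q)).const_mul _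
  have hvm : Measurable v := Measurable.tsum hterm
  have hmono : ∀ x y, u x ≤ u y → ∀ q, d q * (A q).indicator (1 : Sp N → ℝ≥0∞) x ≤
      d q * (A q).indicator (1 : Sp N → ℝ≥0∞) y := by
    intro x y hxy q
    by_cases hx : x ∈ A q
    · rw [indicator_of_mem hx, indicator_of_mem (show y ∈ A q from lt_of_lt_of_le hx hxy)]
      simp
    · rw [indicator_of_notMem hx, mul_zero]; exact zero_le
  have hvtop : ∀ x, v x ≠ ∞ := fun x => by
    refine ((ENNReal.tsum_le_tsum fun q => ?_).trans_lt (hsum.trans ENNReal.one_lt_top)).ne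
    refine le_trans ?_ (hdc q)
    by_cases hx : x ∈ A q
    · rw [indicator_of_mem hx]; simp
    · rw [indicator_of_notMem hx, mul_zero]; exact zero_le
  refine ⟨v, hvm, ?_, fun x y => ⟨fun h => ?_, fun h => ENNReal.tsum_le_tsum (hmono x y h)⟩⟩
  · rw [lintegral_tsum fun q => (hterm q).aemeasurable]
    refine ((ENNReal.tsum_le_tsum fun q => ?_).trans_lt (hsum.trans ENNReal.one_lt_top)).ne
    rw [lintegral_const_mul _ (measurable_one.indicator (hA q)), lintegral_indicator_one (hA q)]
    exact hdA q
  · by_contra hc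
    push Not at hc
    obtain ⟨q, hq1, hq2⟩ := exists_rat_btwn hc
    have hq0 : (0 : ℚ) < q := by exact_mod_cast (hu0 y).trans_lt hq1
    refine not_lt.2 h (ENNReal.tsum_lt_tsum (i := ⟨q, hq0⟩) (hvtop y) (hmono y x hc.le) ?_)
    rw [indicator_of_notMem (show y ∉ A ⟨q, hq0⟩ from not_lt.2 hq1.le),
      indicator_of_mem (show x ∈ A ⟨q, hq0⟩ from hq2)]
    simpa using pos_iff_ne_zero.2 (hd0 ⟨q, hq0⟩)

/-! ### Hyperplanes halving the mass -/

lemma volume_hyperplane {e : Sp N} (he : ‖e‖ = 1) (s : ℝ) :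
    volume {x : Sp N | inner ℝ x e = s} = 0 := by
  have hne : (ℝ ∙ e)ᗮ ≠ ⊤ := by
    intro h
    have : e ∈ (ℝ ∙ e)ᗮ := h ▸ Submodule.mem_top
    rw [Submodule.mem_orthogonal_singleton_iff_inner_left, real_inner_self_eq_norm_sq, he] at this
    norm_num at this
  have h0 := Measure.addHaar_submodule volume _ hne
  rw [← measure_preimage_add_right volume (-(s • e))] at h0
  refine measure_mono_null (fun x hx => ?_) h0
  simp only [mem_preimage, SetLike.mem_coe, Submodule.mem_orthogonal_singleton_iff_inner_left,
    inner_add_left, inner_neg_left, real_inner_smul_left, real_inner_self_eq_norm_sq, he]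
  have : inner ℝ x e = s := hx
  rw [this]; ring

lemma ae_inner_ne {e : Sp N} (he : ‖e‖ = 1) (s : ℝ) : ∀ᵐ x : Sp N, inner ℝ x e ≠ s := by
  have := volume_hyperplane he s
  rw [ae_iff]
  simpa using this

lemma measurableSet_halfspace (e : Sp N) (s : ℝ) : MeasurableSet {x : Sp N | inner ℝ x e < s} :=
  measurableSet_lt (by fun_prop) measurable_const

lemma setLIntegral_halfspace_add {e : Sp N} (he : ‖e‖ = 1) (s : ℝ) (v : Sp N → ℝ≥0∞) :
    (∫⁻ x in {x | inner ℝ x e < s}, v x) + ∫⁻ x in {x | s < inner ℝ x e}, v x = ∫⁻ x, v x := by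
  refine Eq.trans ?_ (lintegral_add_compl v (measurableSet_halfspace e s))
  congr 1
  refine setLIntegral_congr ?_
  filter_upwards [ae_inner_ne he s] with x hx
  refine propext ⟨fun h => not_lt.2 (le_of_lt h), fun h => ?_⟩
  exact lt_of_le_of_ne (not_lt.1 h) hx.symm

lemma setLIntegral_halfspace_refl {e : Sp N} (he : ‖e‖ = 1) (s : ℝ) {v : Sp N → ℝ≥0∞}
    (hv : Measurable v) :
    ∫⁻ x in {x | inner ℝ x e < s}, v (refl e s x) = ∫⁻ x in {x | s < inner ℝ x e}, v x := by
  have hS : MeasurableSet {x : Sp N | s < inner ℝ x e} :=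
    measurableSet_lt measurable_const (by fun_prop)
  rw [← lintegral_indicator (measurableSet_halfspace e s), ← lintegral_indicator hS,
    ← lintegral_refl he s (hv.indicator hS)]
  refine lintegral_congr fun x => ?_
  simp only [indicator_apply, mem_ofPred_eq, inner_refl he]
  congr 1
  exact propext ⟨fun h => by linarith, fun h => by linarith⟩

/-- A hyperplane in a given direction halves an integrable function. -/
lemma exists_halving {e : Sp N} (he : ‖e‖ = 1) {v : Sp N → ℝ≥0∞} (hv : Measurable v)
    (hfin : ∫⁻ x, v x ≠ ∞) :
    ∃ s : ℝ, ∫⁻ x in {x | inner ℝ x e < s}, v x = ∫⁻ x in {x | s < inner ℝ x e}, v x := by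
  set V := ∫⁻ x, v x
  let G : ℝ → ℝ≥0∞ := fun s => ∫⁻ x, {x : Sp N | inner ℝ x e < s}.indicator v x
  have hG : ∀ s, G s = ∫⁻ x in {x | inner ℝ x e < s}, v x := fun s =>
    lintegral_indicator (measurableSet_halfspace e s) v
  have hdom : ∀ (l : Filter ℝ) [l.IsCountablyGenerated] (w : Sp N → ℝ≥0∞),
      (∀ᵐ x, ∀ᶠ s in l, {x : Sp N | inner ℝ x e < s}.indicator v x = w x) →
      Filter.Tendsto G l (nhds (∫⁻ x, w x)) := by
    intro l _ w hw
    refine tendsto_lintegral_filter_of_dominated_convergence v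
      (Filter.Eventually.of_forall fun s => hv.indicator (measurableSet_halfspace e s))
      (Filter.Eventually.of_forall fun s => Filter.Eventually.of_forall fun x =>
        indicator_le_self _ _ _) hfin ?_
    filter_upwards [hw] with x hx using tendsto_nhds_of_eventually_eq hx
  have hcont : Continuous G := by
    refine continuous_iff_continuousAt.2 fun s0 => hdom _ _ ?_
    filter_upwards [ae_inner_ne he s0] with x hx
    rcases lt_or_gt_of_ne hx with h | h
    · filter_upwards [lt_mem_nhds h] with s hs
      rw [indicator_of_mem (show x ∈ {x : Sp N | inner ℝ x e < s} from hs),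
        indicator_of_mem (show x ∈ {x : Sp N | inner ℝ x e < s0} from h)]
    · filter_upwards [gt_mem_nhds h] with s hs
      rw [indicator_of_notMem (show x ∉ {x : Sp N | inner ℝ x e < s} from not_lt.2 hs.le),
        indicator_of_notMem (show x ∉ {x : Sp N | inner ℝ x e < s0} from not_lt.2 h.le)]
  have hbot : Filter.Tendsto G Filter.atBot (nhds 0) := by
    rw [← lintegral_zero (μ := (volume : Measure (Sp N)))]
    refine hdom _ _ (Filter.Eventually.of_forall fun x => ?_)
    filter_upwards [Filter.eventually_le_atBot (inner ℝ x e)] with s hs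
    exact indicator_of_notMem (show x ∉ {x : Sp N | inner ℝ x e < s} from not_lt.2 hs) _
  have htop : Filter.Tendsto G Filter.atTop (nhds V) := by
    refine hdom _ _ (Filter.Eventually.of_forall fun x => ?_)
    filter_upwards [Filter.eventually_gt_atTop (inner ℝ x e)] with s hs
    exact indicator_of_mem (show x ∈ {x : Sp N | inner ℝ x e < s} from hs) _
  -- Intermediate value theorem; `G` is continuous because hyperplanes are null. Zero mass is
  -- separate, since `V / 2` is then not strictly between the limits.
  obtain ⟨s, hs⟩ : ∃ s, G s = V / 2 := by
    by_cases hV : V = 0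
    · refine ⟨0, ?_⟩
      rw [hV, ENNReal.zero_div]
      refine le_antisymm ?_ zero_le
      rw [hG, ← hV]
      exact setLIntegral_le_lintegral _ _
    · refine mem_range_of_exists_le_of_exists_ge hcont ?_ ?_
      · exact ((hbot.eventually (gt_mem_nhds (ENNReal.half_pos hV))).exists).imp fun _ h => h.le
      · exact ((htop.eventually (lt_mem_nhds (ENNReal.half_lt_self hV hfin))).exists).imp
          fun _ h => h.le
  refine ⟨s, ?_⟩
  have h1 := setLIntegral_halfspace_add he s v
  rw [hG] at hs
  rw [hs] at h1 ⊢
  have h2 : V / 2 + V / 2 = V := ENNReal.add_halves V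
  exact ((ENNReal.add_right_inj (ENNReal.div_ne_top hfin (by norm_num))).1 (h1.trans h2.symm)).symm

lemma ae_refl_eq_of_half {e : Sp N} (he : ‖e‖ = 1) {s : ℝ} {u : Sp N → ℝ}
    (h : ∀ᵐ x, inner ℝ x e < s → u (refl e s x) = u x) : ∀ᵐ x, u (refl e s x) = u x := by
  filter_upwards [h, (measurePreserving_refl he s).quasiMeasurePreserving.ae h] with x h1 h2
  rcases lt_trichotomy (inner ℝ x e) s with hx | hx | hx
  · exact h1 hx
  · rw [refl_of_inner_eq hx]
  · rw [refl_refl he, inner_refl he] at h2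
    exact (h2 (by linarith)).symm

/-- A function ordered with respect to a reflection which leaves at least as much mass on the smaller
side is symmetric on the half-space. -/
lemma ae_eq_of_ordered_of_mass {e : Sp N} (he : ‖e‖ = 1) {s : ℝ} {u : Sp N → ℝ}
    {v : Sp N → ℝ≥0∞} (hv : Measurable v) (hfin : ∫⁻ x, v x ≠ ∞)
    (huv : ∀ x y, v x ≤ v y ↔ u x ≤ u y)
    (h : ((∀ᵐ x, inner ℝ x e < s → u (refl e s x) ≤ u x) ∧
        ∫⁻ x in {x | inner ℝ x e < s}, v x ≤ ∫⁻ x in {x | s < inner ℝ x e}, v x) ∨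
      ((∀ᵐ x, inner ℝ x e < s → u x ≤ u (refl e s x)) ∧
        ∫⁻ x in {x | s < inner ℝ x e}, v x ≤ ∫⁻ x in {x | inner ℝ x e < s}, v x)) :
    ∀ᵐ x, inner ℝ x e < s → u (refl e s x) = u x := by
  have hH := measurableSet_halfspace e s
  have hvr : Measurable fun x => v (refl e s x) := hv.comp (measurable_refl e s)
  rw [← setLIntegral_halfspace_refl he s hv] at h
  have key : ∀ᵐ x, inner ℝ x e < s → v (refl e s x) = v x := by
    rcases h with ⟨h1, h2⟩ | ⟨h1, h2⟩
    · have h3 : (fun x => v (refl e s x)) ≤ᵐ[volume.restrict {x | inner ℝ x e < s}] v := by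
        refine (ae_restrict_iff' hH).2 ?_
        filter_upwards [h1] with x hx hxs using (huv _ _).2 (hx hxs)
      refine (ae_restrict_iff' hH).1 (ae_eq_of_ae_le_of_lintegral_le h3 ?_ hv.aemeasurable h2)
      exact ((lintegral_mono_ae h3).trans_lt
        ((setLIntegral_le_lintegral _ _).trans_lt hfin.lt_top)).ne
    · have h3 : v ≤ᵐ[volume.restrict {x | inner ℝ x e < s}] fun x => v (refl e s x) := by
        refine (ae_restrict_iff' hH).2 ?_
        filter_upwards [h1] with x hx hxs using (huv _ _).2 (hx hxs)
      have h4 := (ae_restrict_iff' hH).1 (ae_eq_of_ae_le_of_lintegral_le h3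
        ((setLIntegral_le_lintegral _ _).trans_lt hfin.lt_top).ne hvr.aemeasurable h2)
      filter_upwards [h4] with x hx hxs using (hx hxs).symm
  filter_upwards [key] with x hx hxs
  exact le_antisymm ((huv _ _).1 (hx hxs).le) ((huv _ _).1 (hx hxs).ge)

/-- `u` is ordered with respect to every reflection. -/
def IsOrdered (u : Sp N → ℝ) : Prop :=
  ∀ e : Sp N, ‖e‖ = 1 → ∀ s : ℝ, (∀ᵐ x, inner ℝ x e < s → u (refl e s x) ≤ u x) ∨
      (∀ᵐ x, inner ℝ x e < s → u x ≤ u (refl e s x))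

/-- An ordered function is invariant under a reflection in every direction. -/
lemma IsOrdered.exists_symm {u : Sp N → ℝ} (h : IsOrdered u) (hu : Measurable u)
    (hu0 : ∀ x, 0 ≤ u x) (hlev : ∀ τ : ℝ, 0 < τ → volume {x | τ < u x} < ∞) {e : Sp N}
    (he : ‖e‖ = 1) : ∃ s, ∀ᵐ x, u (refl e s x) = u x := by
  obtain ⟨v, hv, hfin, huv⟩ := exists_integrable_weight hu hu0 hlev
  obtain ⟨s, hs⟩ := exists_halving he hv hfin
  refine ⟨s, ae_refl_eq_of_half he (ae_eq_of_ordered_of_mass he hv hfin huv ?_)⟩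
  exact (h e he s).imp (fun h1 => ⟨h1, hs.le⟩) (fun h1 => ⟨h1, hs.ge⟩)

/-- An ordered function is invariant under a point reflection. -/
lemma IsOrdered.exists_center {u : Sp N → ℝ} (h : IsOrdered u) (hu : Measurable u)
    (hu0 : ∀ x, 0 ≤ u x) (hlev : ∀ τ : ℝ, 0 < τ → volume {x | τ < u x} < ∞) :
    ∃ a : Sp N, ∀ᵐ x, u (a + a - x) = u x := by
  have hb : ∀ i : Fin N, ‖(EuclideanSpace.single i (1 : ℝ) : Sp N)‖ = 1 := fun i => by simp
  choose s hs using fun i => h.exists_symm hu hu0 hlev (hb i)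
  -- Reflections in coordinate directions act on different coordinates. Composing those in `S` flips
  -- the coordinates in `S`; flipping all of them is a point reflection.
  have key : ∀ S : Finset (Fin N), ∀ᵐ x : Sp N,
      u (WithLp.toLp 2 fun i => if i ∈ S then 2 * s i - x i else x i) = u x := by
    intro S
    induction S using Finset.induction_on with
    | empty => exact Filter.Eventually.of_forall fun x => by simp
    | insert i S hi ih =>
      filter_upwards [(measurePreserving_refl (hb i) (s i)).quasiMeasurePreserving.ae ih, hs i]
        with x h1 h2
      rw [← h2, ← h1]
      congr 1
      ext j
      by_cases hj : j = i
      · subst hj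
        simp [refl, hi, EuclideanSpace.inner_single_right]
        ring
      · simp [refl, hj, EuclideanSpace.inner_single_right]
  refine ⟨WithLp.toLp 2 s, ?_⟩
  filter_upwards [key Finset.univ] with x hx
  rw [← hx]
  congr 1
  ext i
  simp
  ring

lemma refl_add (e : Sp N) (s : ℝ) (x a : Sp N) :
    refl e s x + a = refl e (s + inner ℝ a e) (x + a) := by
  simp only [refl, inner_add_left]
  module

lemma ae_comp_add {p : Sp N → Prop} (h : ∀ᵐ x, p x) (a : Sp N) : ∀ᵐ x, p (x + a) :=
  (measurePreserving_add_right volume a).quasiMeasurePreserving.ae h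

lemma IsOrdered.comp_add {u : Sp N → ℝ} (h : IsOrdered u) (a : Sp N) :
    IsOrdered fun x => u (x + a) := by
  intro e he s
  refine (h e he (s + inner ℝ a e)).imp (fun h1 => ?_) (fun h1 => ?_)
  · filter_upwards [ae_comp_add h1 a] with x hx hxs
    rw [refl_add]
    exact hx (by rw [inner_add_left]; linarith)
  · filter_upwards [ae_comp_add h1 a] with x hx hxs
    rw [refl_add]
    exact hx (by rw [inner_add_left]; linarith)

/-- Under the opposite order the far side has the larger values. By evenness the half-space
containing the origin has at least half of the mass, so the two sides agree almost everywhere and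
the desired order holds as well. -/
lemma IsOrdered.le_of_even {u : Sp N → ℝ} (h : IsOrdered u) (hu : Measurable u)
    (hu0 : ∀ x, 0 ≤ u x) (hlev : ∀ τ : ℝ, 0 < τ → volume {x | τ < u x} < ∞)
    (heven : ∀ᵐ x, u (-x) = u x) {e : Sp N} (he : ‖e‖ = 1) {s : ℝ} (hs : 0 < s) :
    ∀ᵐ x, inner ℝ x e < s → u (refl e s x) ≤ u x := by
  rcases h e he s with h1 | h1
  · exact h1
  obtain ⟨v, hv, hfin, huv⟩ := exists_integrable_weight hu hu0 hlev
  have hS : MeasurableSet {x : Sp N | 0 < inner ℝ x e} :=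
    measurableSet_lt measurable_const (by fun_prop)
  have h0 : ∫⁻ x in {x | 0 < inner ℝ x e}, v x = ∫⁻ x in {x | inner ℝ x e < 0}, v x := by
    rw [← lintegral_indicator (measurableSet_halfspace e 0), ← lintegral_indicator hS,
      ← (Measure.measurePreserving_neg volume).lintegral_comp (hv.indicator hS)]
    refine lintegral_congr_ae ?_
    filter_upwards [heven] with x hx
    have hvx : v (-x) = v x := le_antisymm ((huv _ _).2 hx.le) ((huv _ _).2 hx.ge)
    simp only [indicator_apply, mem_ofPred_eq, inner_neg_left, hvx, Left.neg_pos_iff]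
  have h2 := ae_eq_of_ordered_of_mass he hv hfin huv (Or.inr ⟨h1, ?_⟩)
  · filter_upwards [h2] with x hx hxs using (hx hxs).le
  · calc ∫⁻ x in {x | s < inner ℝ x e}, v x ≤ ∫⁻ x in {x | 0 < inner ℝ x e}, v x :=
          lintegral_mono_set fun x hx => hs.trans hx
      _ = ∫⁻ x in {x | inner ℝ x e < 0}, v x := h0
      _ ≤ _ := lintegral_mono_set fun x hx => lt_trans hx hs

/-- A function ordered with respect to every reflection is a translate of its rearrangement. -/
theorem IsOrdered.exists_translate (hN : 1 ≤ N) {u : Sp N → ℝ} (h : IsOrdered u)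
    (hu : Measurable u) (hu0 : ∀ x, 0 ≤ u x)
    (hlev : ∀ τ : ℝ, 0 < τ → volume {x | τ < u x} < ∞) :
    ∃ a : Sp N, (fun x => u (x + a)) =ᵐ[volume] rearrReal u := by
  obtain ⟨a, ha⟩ := h.exists_center hu hu0 hlev
  have hw : Measurable fun x => u (x + a) := hu.comp (measurable_add_const a)
  have hvol : ∀ t : ℝ, volume {x | t < u (x + a)} = volume {x | t < u x} := fun t =>
    measure_preimage_add_right volume a {x | t < u x}
  have hlevw : ∀ τ : ℝ, 0 < τ → volume {x | τ < u (x + a)} < ∞ := fun τ hτ => by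
    rw [hvol]; exact hlev τ hτ
  have heven : ∀ᵐ x, u (-x + a) = u (x + a) := by
    filter_upwards [ae_comp_add ha a] with x hx
    rw [← hx]
    congr 1
    abel
  refine ⟨a, ?_⟩
  have hr : rearrReal (fun x => u (x + a)) = rearrReal u := by
    have := rearr_congr (u := fun x => u (x + a)) (v := u) fun t _ => hvol t
    ext x; simp only [rearrReal, this]
  rw [← hr]
  exact ae_eq_rearrReal_of_ordered hN hw (fun x => hu0 _) hlevw fun e he s hs =>
    (h.comp_add a).le_of_even hw (fun x => hu0 _) hlevw heven he hs

/-! ### The case of equality for strictly convex integrands -/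

lemma rearrReal_congr {u v : Sp N → ℝ}
    (h : ∀ t : ℝ, 0 < t → volume {x | t < u x} = volume {x | t < v x}) :
    rearrReal u = rearrReal v := by
  have := rearr_congr h
  ext x
  simp only [rearrReal, this]

/-- Polarization does not change the rearrangement, so `E[u*] ≤ E[pol u] ≤ E[u] = E[u*]`. Equality
for every hyperplane makes `u` ordered across each of them. -/
theorem exists_translate_of_energy_eq (hN : 1 ≤ N) {J : ℝ → ℝ} (hJ : StrictConvexOn ℝ univ J)
    (hJ0 : ∀ t, 0 ≤ J t) (hz : J 0 = 0) {k : Sp N → ℝ≥0∞} (hk : IsStrictSymmDecreasing k)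
    (hki : ∫⁻ x, k x ≠ ∞) {u : Sp N → ℝ} (hu : Measurable u) (hu0 : ∀ x, 0 ≤ u x)
    (hlev : ∀ τ : ℝ, 0 < τ → volume {x | τ < u x} < ∞) (hfin : energy J k u ≠ ∞)
    (heq : energy J k u = energy J k (rearrReal u)) :
    ∃ a : Sp N, (fun x => u (x + a)) =ᵐ[volume] rearrReal u := by
  have hkm := hk.1.measurable hN
  refine IsOrdered.exists_translate hN (fun e he s => ?_) hu hu0 hlev
  refine ordered_of_energy_pol_eq hJ hJ0 hk hkm he s hu hfin
    (le_antisymm (energy_pol_le hJ.convexOn hJ0 hk.1 hkm he s hu) ?_)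
  have hvol := volume_pol_level he s hu
  rw [heq, ← rearrReal_congr fun t _ => hvol t]
  refine energy_rearrReal_le hN hJ.convexOn hJ0 hz hk.1 hki (measurable_pol e s hu) (fun x => ?_)
    fun τ hτ => by rw [hvol]; exact hlev τ hτ
  unfold pol
  split_ifs
  · exact (hu0 x).trans (le_max_left _ _)
  · exact le_min (hu0 x) (hu0 _)

lemma energy_comp_add (J : ℝ → ℝ) (k : Sp N → ℝ≥0∞) (u : Sp N → ℝ) (a : Sp N) :
    energy J k (fun x => u (x + a)) = energy J k u := by
  unfold energy
  rw [← lintegral_add_right_eq_self (fun x => ∫⁻ y, ENNReal.ofReal (J (u x - u y)) * k (x - y)) a]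
  refine lintegral_congr fun x => ?_
  rw [← lintegral_add_right_eq_self
    (fun y => ENNReal.ofReal (J (u (x + a) - u y)) * k (x + a - y)) a]
  simp

/-- Radial monotonicity makes the level set and the centred ball of the same volume nested one way
or the other; equal finite measure then leaves a null difference. -/
lemma ae_eq_setRearr_of_isSymmDecreasing (hN : 1 ≤ N) {g : Sp N → ℝ≥0∞} (hg : IsSymmDecreasing g)
    (c : ℝ≥0∞) (hfin : volume {x | c < g x} ≠ ∞) :
    {x | c < g x} =ᵐ[volume] setRearr {x | c < g x} := by
  set S := {x | c < g x}
  have hS : MeasurableSet S := measurableSet_lt measurable_const (hg.measurable hN)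
  have hvol := volume_setRearr hN hfin
  by_cases h : S ⊆ setRearr S
  · exact ae_eq_of_subset_of_measure_ge h hvol.le hS.nullMeasurableSet (hvol ▸ hfin)
  · obtain ⟨x, hx, hx'⟩ := not_subset.1 h
    refine (ae_eq_of_subset_of_measure_ge (fun y hy => ?_) hvol.ge
      (measurableSet_setRearr S).nullMeasurableSet hfin).symm
    have h1 := not_lt.1 (fun h => hx' (mem_setRearr.2 h))
    exact lt_of_lt_of_le (show c < g x from hx) (hg y x ((mem_setRearr.1 hy).le.trans h1))

theorem ae_eq_rearrReal_of_ofReal_ae_eq (hN : 1 ≤ N) {u : Sp N → ℝ} (hu : Measurable u)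
    (hu0 : ∀ x, 0 ≤ u x) (hlev : ∀ τ : ℝ, 0 < τ → volume {x | τ < u x} < ∞) {g : Sp N → ℝ≥0∞}
    (hg : IsSymmDecreasing g) (h : ∀ᵐ x, ENNReal.ofReal (u x) = g x) :
    u =ᵐ[volume] rearrReal u := by
  refine ae_eq_of_level_ae_eq hu0 (rearrReal_nonneg u) fun t ht => ?_
  refine Filter.EventuallyEq.trans ?_ (level_rearrReal_ae_eq hN hu hlev ht).symm
  have h1 : {x | t < u x} =ᵐ[volume] {x | ENNReal.ofReal t < g x} := by
    filter_upwards [h] with x hx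
    refine propext ?_
    change t < u x ↔ ENNReal.ofReal t < g x
    rw [← hx, ENNReal.ofReal_lt_ofReal_iff_of_nonneg ht.le]
  have h2 := measure_congr h1
  have h3 := ae_eq_setRearr_of_isSymmDecreasing hN hg (ENNReal.ofReal t) (h2 ▸ (hlev t ht).ne)
  rw [← setRearr_congr h2] at h3
  exact h1.trans h3

theorem energy_eq_of_isTranslate (hN : 1 ≤ N) (J : ℝ → ℝ) (k : Sp N → ℝ≥0∞) {u : Sp N → ℝ}
    (hu : Measurable u) (hu0 : ∀ x, 0 ≤ u x)
    (hlev : ∀ τ : ℝ, 0 < τ → volume {x | τ < u x} < ∞) (h : IsTranslateOfSymmDecreasing u) :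
    energy J k u = energy J k (rearrReal u) := by
  obtain ⟨a, g, hg, hug⟩ := h
  have hvol : ∀ t : ℝ, volume {x | t < u (x + a)} = volume {x | t < u x} := fun t =>
    measure_preimage_add_right volume a {x | t < u x}
  have h1 : ∀ᵐ x, ENNReal.ofReal (u (x + a)) = g x := by
    filter_upwards [ae_comp_add hug a] with x hx
    rwa [add_sub_cancel_right] at hx
  have h2 := ae_eq_rearrReal_of_ofReal_ae_eq hN (hu.comp (measurable_add_const a))
    (fun x => hu0 _) (fun τ hτ => (hvol τ).trans_lt (hlev τ hτ)) hg h1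
  have h3 : rearrReal (u ∘ fun x => x + a) = rearrReal u := rearrReal_congr fun t _ => hvol t
  rw [h3] at h2
  rw [← energy_comp_add J k u a]
  exact energy_congr_ae h2

theorem isTranslate_of_ae_eq (hN : 1 ≤ N) {u : Sp N → ℝ} (hu : Measurable u)
    (hlev : ∀ τ : ℝ, 0 < τ → volume {x | τ < u x} < ∞) {a : Sp N}
    (h : (fun x => u (x + a)) =ᵐ[volume] rearrReal u) : IsTranslateOfSymmDecreasing u := by
  refine ⟨a, rearr u, isSymmDecreasing_rearr u, ?_⟩
  have h1 : ∀ᵐ x, ENNReal.ofReal (u (x + a)) = rearr u x := by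
    filter_upwards [h, ae_ne_zero hN] with x hx hx0
    rw [hx, rearrReal, ENNReal.ofReal_toReal (rearr_lt_top hN hu hlev hx0).ne]
  filter_upwards [ae_comp_add h1 (-a)] with x hx
  rwa [neg_add_cancel_right, ← sub_eq_add_neg] at hx

/-! ### The total variation case -/

/-- The real-valued characteristic function of a set. -/
def chi (A : Set (Sp N)) : Sp N → ℝ := A.indicator 1

lemma chi_nonneg (A : Set (Sp N)) (x : Sp N) : 0 ≤ chi A x :=
  indicator_nonneg (fun _ _ => zero_le_one) x

lemma chi_eq_one {A : Set (Sp N)} {x : Sp N} (hx : x ∈ A) : chi A x = 1 := indicator_of_mem hx _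

lemma chi_eq_zero {A : Set (Sp N)} {x : Sp N} (hx : x ∉ A) : chi A x = 0 := indicator_of_notMem hx _

lemma measurable_chi {A : Set (Sp N)} (hA : MeasurableSet A) : Measurable (chi A) :=
  measurable_one.indicator hA

lemma chi_congr_ae {A B : Set (Sp N)} (h : A =ᵐ[volume] B) : chi A =ᵐ[volume] chi B :=
  indicator_ae_eq_of_ae_eq_set h

lemma level_chi_of_lt {A : Set (Sp N)} {t : ℝ} (ht : 0 < t) (ht1 : t < 1) :
    {x | t < chi A x} = A := by
  ext x
  by_cases hx : x ∈ A
  · simp [chi_eq_one hx, hx, ht1]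
  · simp [chi_eq_zero hx, hx, ht.le]

lemma level_chi_of_le {A : Set (Sp N)} {t : ℝ} (ht1 : 1 ≤ t) : {x | t < chi A x} = ∅ := by
  ext x
  by_cases hx : x ∈ A
  · simp [chi_eq_one hx, ht1]
  · simp [chi_eq_zero hx, zero_le_one.trans ht1]

lemma volume_level_chi_lt_top {A : Set (Sp N)} (hfin : volume A < ∞) (τ : ℝ) (hτ : 0 < τ) :
    volume {x | τ < chi A x} < ∞ := by
  rcases lt_or_ge τ 1 with h | h
  · rwa [level_chi_of_lt hτ h]
  · rw [level_chi_of_le h]; simp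

lemma setRearr_empty (hN : 1 ≤ N) : setRearr (∅ : Set (Sp N)) = ∅ := by
  ext x
  rw [mem_setRearr, rad, measure_empty, ENNReal.toReal_zero, zero_div,
    Real.zero_rpow (by positivity)]
  simp

lemma rearrReal_chi (hN : 1 ≤ N) {A : Set (Sp N)} (hA : MeasurableSet A) (hfin : volume A < ∞) :
    rearrReal (chi A) =ᵐ[volume] chi (setRearr A) := by
  refine ae_eq_of_level_ae_eq (rearrReal_nonneg _) (chi_nonneg _) fun t ht => ?_
  refine (level_rearrReal_ae_eq hN (measurable_chi hA) (volume_level_chi_lt_top hfin) ht).trans ?_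
  rcases lt_or_ge t 1 with h | h
  · rw [level_chi_of_lt ht h, level_chi_of_lt ht h]
    exact Filter.EventuallyEq.rfl
  · rw [level_chi_of_le h, level_chi_of_le h, setRearr_empty hN]
    exact Filter.EventuallyEq.rfl

/-- `|t|` and `t²` agree on `{-1, 0, 1}`. This transfers the equality case for the strictly convex
`t²` to `|t|`, which is not strictly convex. -/
lemma energy_sq_chi (k : Sp N → ℝ≥0∞) (A : Set (Sp N)) :
    energy (fun t => t ^ 2) k (chi A) = energy (fun t => |t|) k (chi A) := by
  refine lintegral_congr fun x => lintegral_congr fun y => ?_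
  by_cases hx : x ∈ A <;> by_cases hy : y ∈ A <;>
    simp [chi_eq_one, chi_eq_zero, hx, hy]

lemma ofReal_abs_sub_eq_lintegral {a b : ℝ} (ha : 0 ≤ a) (hb : 0 ≤ b) :
    ENNReal.ofReal |a - b| = ∫⁻ τ in Ioi (0 : ℝ), (Ico (min a b) (max a b)).indicator 1 τ := by
  rw [setLIntegral_congr Ioi_ae_eq_Ici, ← lintegral_indicator measurableSet_Ici, indicator_indicator,
    inter_eq_right.2, lintegral_indicator_one measurableSet_Ico, Real.volume_Ico,
    max_sub_min_eq_abs']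
  exact fun t ht => (le_min ha hb).trans ht.1

lemma ofReal_abs_chi_sub (u : Sp N → ℝ) (τ : ℝ) (x y : Sp N) :
    ENNReal.ofReal |chi {z | τ < u z} x - chi {z | τ < u z} y| =
      (Ico (min (u x) (u y)) (max (u x) (u y))).indicator 1 τ := by
  have hmem : τ ∈ Ico (min (u x) (u y)) (max (u x) (u y)) ↔ ¬ (τ < u x ↔ τ < u y) := by
    rw [mem_Ico, min_le_iff, lt_max_iff, ← not_lt, ← not_lt]
    tauto
  by_cases hx : τ < u x <;> by_cases hy : τ < u y
  · rw [chi_eq_one (A := {z | τ < u z}) hx, chi_eq_one (A := {z | τ < u z}) hy,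
      indicator_of_notMem (by rw [hmem]; simp [hx, hy])]
    simp
  · rw [chi_eq_one (A := {z | τ < u z}) hx, chi_eq_zero (A := {z | τ < u z}) hy,
      indicator_of_mem (by rw [hmem]; simp [hx, hy])]
    simp
  · rw [chi_eq_zero (A := {z | τ < u z}) hx, chi_eq_one (A := {z | τ < u z}) hy,
      indicator_of_mem (by rw [hmem]; simp [hx, hy])]
    simp
  · rw [chi_eq_zero (A := {z | τ < u z}) hx, chi_eq_zero (A := {z | τ < u z}) hy,
      indicator_of_notMem (by rw [hmem]; simp [hx, hy])]
    simp

lemma measurable_levelDens {k : Sp N → ℝ≥0∞} (hk : Measurable k) {u : Sp N → ℝ}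
    (hu : Measurable u) : Measurable fun p : ℝ × (Sp N × Sp N) =>
      dens (fun t => |t|) k (chi {z | p.1 < u z}) p.2 := by
  have h1 : MeasurableSet {p : ℝ × (Sp N × Sp N) | min (u p.2.1) (u p.2.2) ≤ p.1} :=
    measurableSet_le (by fun_prop) (by fun_prop)
  have h2 : MeasurableSet {p : ℝ × (Sp N × Sp N) | p.1 < max (u p.2.1) (u p.2.2)} :=
    measurableSet_lt (by fun_prop) (by fun_prop)
  have h3 : Measurable fun p : ℝ × (Sp N × Sp N) =>
      (Ico (min (u p.2.1) (u p.2.2)) (max (u p.2.1) (u p.2.2))).indicator (1 : ℝ → ℝ≥0∞) p.1 :=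
    measurable_one.indicator (h1.inter h2)
  simp only [dens, ofReal_abs_chi_sub]
  exact h3.mul (by fun_prop)

lemma measurable_energy_level {k : Sp N → ℝ≥0∞} (hk : Measurable k) {u : Sp N → ℝ}
    (hu : Measurable u) : Measurable fun τ : ℝ => energy (fun t => |t|) k (chi {z | τ < u z}) := by
  have habs : Measurable fun t : ℝ => |t| := continuous_abs.measurable
  have : ∀ τ : ℝ, energy (fun t => |t|) k (chi {z | τ < u z}) =
      ∫⁻ z, dens (fun t => |t|) k (chi {z | τ < u z}) z ∂(volume.prod volume) := fun τ =>
    energy_eq_lintegral_dens habs hk (measurable_chi (measurableSet_lt measurable_const hu))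
  simp only [this]
  exact (measurable_levelDens hk hu).lintegral_prod_right'

/-- The coarea formula. -/
lemma energy_abs_eq_lintegral {k : Sp N → ℝ≥0∞} (hk : Measurable k) {u : Sp N → ℝ}
    (hu : Measurable u) (hu0 : ∀ x, 0 ≤ u x) :
    energy (fun t => |t|) k u =
      ∫⁻ τ in Ioi (0 : ℝ), energy (fun t => |t|) k (chi {z | τ < u z}) := by
  have habs : Measurable fun t : ℝ => |t| := continuous_abs.measurable
  have hm := measurable_levelDens hk hu
  calc energy (fun t => |t|) k u
      = ∫⁻ z, ∫⁻ τ in Ioi (0 : ℝ), dens (fun t => |t|) k (chi {z | τ < u z}) z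
          ∂volume ∂(volume.prod volume) := by
        rw [energy_eq_lintegral_dens habs hk hu]
        refine lintegral_congr fun z => ?_
        simp only [dens, ofReal_abs_chi_sub]
        rw [lintegral_mul_const _ (measurable_one.indicator measurableSet_Ico),
          ← ofReal_abs_sub_eq_lintegral (hu0 _) (hu0 _)]
    _ = ∫⁻ τ in Ioi (0 : ℝ), ∫⁻ z, dens (fun t => |t|) k (chi {z | τ < u z}) z
          ∂(volume.prod volume) :=
        lintegral_lintegral_swap (hm.comp measurable_swap).aemeasurable
    _ = _ := by
        refine lintegral_congr fun τ => ?_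
        rw [energy_eq_lintegral_dens habs hk
          (measurable_chi (measurableSet_lt measurable_const hu))]

/-- Rearrangement commutes with taking level sets, so the coarea formula for `u*` involves the
rearranged level sets of `u`. -/
lemma energy_abs_rearrReal_eq_lintegral (hN : 1 ≤ N) {k : Sp N → ℝ≥0∞} (hk : Measurable k)
    {u : Sp N → ℝ} (hu : Measurable u)
    (hlev : ∀ τ : ℝ, 0 < τ → volume {x | τ < u x} < ∞) :
    energy (fun t => |t|) k (rearrReal u) =
      ∫⁻ τ in Ioi (0 : ℝ), energy (fun t => |t|) k (rearrReal (chi {z | τ < u z})) := by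
  rw [energy_abs_eq_lintegral hk (measurable_rearrReal hN u) (rearrReal_nonneg u)]
  refine setLIntegral_congr_fun measurableSet_Ioi fun τ hτ => energy_congr_ae ?_
  exact (chi_congr_ae (level_rearrReal_ae_eq hN hu hlev hτ)).trans
    (rearrReal_chi hN (measurableSet_lt measurable_const hu) (hlev τ hτ)).symm

lemma convexOn_abs : ConvexOn ℝ univ fun t : ℝ => |t| :=
  convexOn_univ_norm (E := ℝ)

lemma strictConvexOn_sq : StrictConvexOn ℝ univ fun t : ℝ => t ^ 2 :=
  Even.strictConvexOn_pow even_two two_ne_zero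

/-- A set whose perimeter-type energy equals that of its rearrangement is a ball. -/
lemma exists_ball_of_energy_eq (hN : 1 ≤ N) {k : Sp N → ℝ≥0∞} (hk : IsStrictSymmDecreasing k)
    (hki : ∫⁻ x, k x ≠ ∞) {A : Set (Sp N)} (hA : MeasurableSet A) (hAfin : volume A < ∞)
    (hfin : energy (fun t => |t|) k (chi A) ≠ ∞)
    (heq : energy (fun t => |t|) k (chi A) = energy (fun t => |t|) k (rearrReal (chi A))) :
    ∃ (a : Sp N) (r : ℝ), A =ᵐ[volume] Metric.ball a r := by
  have hr := rearrReal_chi hN hA hAfin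
  rw [energy_congr_ae hr, ← energy_sq_chi, ← energy_sq_chi, ← energy_congr_ae hr] at heq
  rw [← energy_sq_chi] at hfin
  obtain ⟨a, ha⟩ := exists_translate_of_energy_eq hN strictConvexOn_sq (fun t => sq_nonneg t)
    (by norm_num) hk hki (measurable_chi hA) (chi_nonneg A) (volume_level_chi_lt_top hAfin) hfin heq
  refine ⟨a, rad A, ?_⟩
  filter_upwards [ae_comp_add (ha.trans hr) (-a)] with x hx
  simp only [neg_add_cancel_right] at hx
  refine propext ?_
  change x ∈ A ↔ x ∈ Metric.ball a (rad A)
  have h1 : x ∈ Metric.ball a (rad A) ↔ x + -a ∈ setRearr A := by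
    rw [mem_setRearr, mem_ball_iff_norm, sub_eq_add_neg]
  rw [h1]
  by_cases h2 : x ∈ A <;> by_cases h3 : x + -a ∈ setRearr A <;>
    simp [h2, h3, chi_eq_one, chi_eq_zero] at hx ⊢

lemma isTranslate_chi_of_ae_eq_ball {A : Set (Sp N)} {a : Sp N} {r : ℝ}
    (h : A =ᵐ[volume] Metric.ball a r) : IsTranslateOfSymmDecreasing (chi A) := by
  refine ⟨a, (Metric.ball 0 r).indicator 1, fun x y hxy => ?_, ?_⟩
  · by_cases hy : y ∈ Metric.ball (0 : Sp N) r
    · have hx : x ∈ Metric.ball (0 : Sp N) r := by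
        rw [mem_ball_zero_iff] at hy ⊢
        exact hxy.trans_lt hy
      rw [indicator_of_mem hy, indicator_of_mem hx]
      rfl
    · rw [indicator_of_notMem hy]; exact zero_le
  · filter_upwards [chi_congr_ae h] with x hx
    rw [hx]
    have h1 : x ∈ Metric.ball a r ↔ x - a ∈ Metric.ball (0 : Sp N) r := by
      rw [mem_ball_iff_norm, mem_ball_zero_iff]
    by_cases h2 : x ∈ Metric.ball a r
    · rw [chi_eq_one h2, indicator_of_mem (h1.1 h2)]; simp
    · rw [chi_eq_zero h2, indicator_of_notMem (mt h1.2 h2)]; simp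

/-- By the coarea formula both energies are integrals over levels with ordered integrands. As they
are finite, equality holds exactly when the integrands agree at almost every level, that is, when
almost every level set is a ball. -/
theorem energy_abs_eq_iff (hN : 1 ≤ N) {k : Sp N → ℝ≥0∞} (hk : IsStrictSymmDecreasing k)
    (hki : ∫⁻ x, k x ≠ ∞) {u : Sp N → ℝ} (hu : Measurable u) (hu0 : ∀ x, 0 ≤ u x)
    (hlev : ∀ τ : ℝ, 0 < τ → volume {x | τ < u x} < ∞)
    (hfin : energy (fun t => |t|) k u ≠ ∞) :
    energy (fun t => |t|) k u = energy (fun t => |t|) k (rearrReal u) ↔ LevelSetsAreBalls u := by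
  have hkm := hk.1.measurable hN
  have hA : ∀ τ : ℝ, MeasurableSet {z | τ < u z} := fun τ => measurableSet_lt measurable_const hu
  have hco := energy_abs_eq_lintegral hkm hu hu0
  have hco' := energy_abs_rearrReal_eq_lintegral hN hkm hu hlev
  have hem := measurable_energy_level hkm hu
  constructor
  · intro heq
    have hle : (fun τ => energy (fun t => |t|) k (rearrReal (chi {z | τ < u z})))
        ≤ᵐ[volume.restrict (Ioi (0 : ℝ))]
        fun τ => energy (fun t => |t|) k (chi {z | τ < u z}) := by
      refine (ae_restrict_iff' measurableSet_Ioi).2 (Filter.Eventually.of_forall fun τ hτ => ?_)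
      exact energy_rearrReal_le hN convexOn_abs (fun t => abs_nonneg t) abs_zero hk.1 hki
        (measurable_chi (hA τ)) (chi_nonneg _) (volume_level_chi_lt_top (hlev τ hτ))
    have hae := ae_eq_of_ae_le_of_lintegral_le hle (by rw [← hco', ← heq]; exact hfin)
      hem.aemeasurable (by rw [← hco', ← hco, heq])
    have htop := ae_lt_top hem (hco ▸ hfin)
    filter_upwards [hae, htop, ae_restrict_mem measurableSet_Ioi] with τ h1 h2 h3
    exact exists_ball_of_energy_eq hN hk hki (hA τ) (hlev τ h3) h2.ne h1.symm
  · intro h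
    rw [hco, hco']
    refine lintegral_congr_ae ?_
    filter_upwards [h, ae_restrict_mem measurableSet_Ioi] with τ h1 h2
    obtain ⟨a, r, har⟩ := h1
    exact energy_eq_of_isTranslate hN _ k (measurable_chi (hA τ)) (chi_nonneg _)
      (volume_level_chi_lt_top (hlev τ h2)) (isTranslate_chi_of_ae_eq_ball har)

/-! ### Independence of the almost everywhere representative -/

lemma isTranslate_congr_ae {u v : Sp N → ℝ} (h : u =ᵐ[volume] v) :
    IsTranslateOfSymmDecreasing u ↔ IsTranslateOfSymmDecreasing v := by
  refine exists_congr fun a => exists_congr fun g => and_congr_right fun _ => ?_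
  exact Filter.eventually_congr (h.mono fun x hx => by rw [hx])

lemma level_congr_ae {u v : Sp N → ℝ} (h : u =ᵐ[volume] v) (t : ℝ) :
    {x | t < u x} =ᵐ[volume] {x | t < v x} := by
  filter_upwards [h] with x hx
  refine propext ?_
  change t < u x ↔ t < v x
  rw [hx]

lemma levelSetsAreBalls_congr_ae {u v : Sp N → ℝ} (h : u =ᵐ[volume] v) :
    LevelSetsAreBalls u ↔ LevelSetsAreBalls v := by
  refine Filter.eventually_congr (Filter.Eventually.of_forall fun τ => ?_)
  refine exists_congr fun a => exists_congr fun r => ?_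
  exact ⟨fun h1 => (level_congr_ae h τ).symm.trans h1, fun h1 => (level_congr_ae h τ).trans h1⟩

end SymmRearr

end

theorem lemmaA2 (N : ℕ) (hN : 1 ≤ N)
    (J : ℝ → ℝ) (hJ_nonneg : ∀ t, 0 ≤ J t) (hJ_convex : ConvexOn ℝ univ J) (hJ_zero : J 0 = 0)
    (k : EuclideanSpace ℝ (Fin N) → ℝ≥0∞) (hk_int : Integrable k volume)
    (hk_symm : SymmRearr.IsSymmDecreasing k)
    (u : EuclideanSpace ℝ (Fin N) → ℝ) (hu_meas : AEMeasurable u volume)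
    (hu_nonneg : ∀ x, 0 ≤ u x)
    (hu_energy : SymmRearr.energy J k u < ∞)
    (hu_level : ∀ τ : ℝ, 0 < τ → volume {x | τ < u x} < ∞) :
    SymmRearr.energy J k (SymmRearr.rearrReal u) ≤ SymmRearr.energy J k u ∧
    (StrictConvexOn ℝ univ J → SymmRearr.IsStrictSymmDecreasing k →
      (SymmRearr.energy J k u = SymmRearr.energy J k (SymmRearr.rearrReal u) ↔
        SymmRearr.IsTranslateOfSymmDecreasing u)) ∧
    ((∀ t, J t = |t|) → SymmRearr.IsStrictSymmDecreasing k →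
      (SymmRearr.energy J k u = SymmRearr.energy J k (SymmRearr.rearrReal u) ↔
        SymmRearr.LevelSetsAreBalls u)) := by
  have hki : ∫⁻ x, k x ≠ ∞ := by
    have := hk_int.hasFiniteIntegral
    simpa only [HasFiniteIntegral, enorm_eq_self] using this.ne
  -- All assertions depend only on the almost everywhere class of `u`, so a Borel representative may
  -- be used; the maximum with `0` makes it nonnegative everywhere.
  obtain ⟨v, hv, hv0, huv⟩ : ∃ v : EuclideanSpace ℝ (Fin N) → ℝ, Measurable v ∧ (∀ x, 0 ≤ v x) ∧
      u =ᵐ[volume] v := by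
    refine ⟨fun x => max (hu_meas.mk u x) 0, hu_meas.measurable_mk.max measurable_const,
      fun x => le_max_right _ _, ?_⟩
    filter_upwards [hu_meas.ae_eq_mk] with x hx
    rw [← hx, max_eq_left (hu_nonneg x)]
  have hvol : ∀ t, volume {x | t < u x} = volume {x | t < v x} := fun t =>
    measure_congr (SymmRearr.level_congr_ae huv t)
  have hlev : ∀ τ : ℝ, 0 < τ → volume {x | τ < v x} < ∞ := fun τ hτ =>
    hvol τ ▸ hu_level τ hτ
  rw [SymmRearr.rearrReal_congr fun t _ => hvol t, SymmRearr.energy_congr_ae huv,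
    SymmRearr.isTranslate_congr_ae huv, SymmRearr.levelSetsAreBalls_congr_ae huv]
  rw [SymmRearr.energy_congr_ae huv] at hu_energy
  refine ⟨SymmRearr.energy_rearrReal_le hN hJ_convex hJ_nonneg hJ_zero hk_symm hki hv hv0 hlev,
    fun hJ hk => ⟨fun heq => ?_, SymmRearr.energy_eq_of_isTranslate hN J k hv hv0 hlev⟩,
    fun hJ hk => ?_⟩
  · obtain ⟨a, ha⟩ := SymmRearr.exists_translate_of_energy_eq hN hJ hJ_nonneg hJ_zero hk hki hv hv0
      hlev hu_energy.ne heq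
    exact SymmRearr.isTranslate_of_ae_eq hN hv hlev ha
  · obtain rfl : J = fun t => |t| := funext hJ
    exact SymmRearr.energy_abs_eq_iff hN hk hki hv hv0 hlev hu_energy.ne
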